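/- Let $M^n$ be a nonempty smooth manifold and let $x:M^n\to\mathbb{R}^{n+1}$ be a smooth immersion with smooth unit normal field $\xi$, without umbilic points and with all principal curvatures $k_1,\dots,k_n$ nonzero (where $d\xi(e_i)=-k_i\,dx(e_i)$ for principal vectors $e_i$). Put $r_i=1/k_i$, $r=\frac1n\sum_i r_i$, $\rho=\big(\sum_i (r-r_i)^2\big)^{1/2}>0$. On $\mathbb{R}^{n+4}$ use the inner product $\langle X,X'\rangle=-X_1X'_1+X_2X'_2+\cdots+X_{n+3}X'_{n+3}-X_{n+4}X'_{n+4}$ and set $$Y=\rho\,(x\cdot\xi,-x\cdot\xi,\xi,1),\qquad g=\langle dY,dY\rangle=\rho^2\,d\xi\cdot d\xi,\qquad N=\tfrac1n\Delta_gY+\tfrac1{2n^2}\langle\Delta_gY,\Delta_gY\rangle Y,$$ $$\eta=\big(\tfrac12(1+|x|^2),\tfrac12(1-|x|^2),x,0\big)+r\,(x\cdot\xi,-x\cdot\xi,\xi,1),\qquad P=(1,-1,0,0).$$ The Laguerre tensor $\mathbb{L}$ and the Laguerre form $\mathbb{C}$ are defined by $E_i(N)=\sum_j L_{ij}E_j(Y)+C_iP$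 for local $g$-orthonormal frames $(E_i)$; equivalently, $\mathbb{L}(v,w)=\langle dN(v),dY(w)\rangle$ and $\mathbb{C}(v)=-\langle dN(v),\eta\rangle$. The hypersurface $x$ is called L-isotropic, with constant $\lambda\in\mathbb{R}$, if $\mathbb{C}=0$ and $\mathbb{L}=\lambda g$, i.e. $L_{ij}=\lambda\delta_{ij}$. Suppose that $x$ is L-isotropic with constant $\lambda$. Then: 1. If $x$ has exactly two distinct principal curvatures at every point, then $\lambda=0$. 2. If $n\ge 3$ and $\lambda>0$, then $x$ has at least three distinct (nonvanishing) principal curvatures, in the following sense: the points at which at least three of the principal curvatures are distinct form a dense subset of $M$. In particular, if the number of distinct principal curvatures is constant on $M$, then it is at least three at every point. -/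

import Mathlib

open scoped Manifold ContDiff

noncomputable section

namespace Laguerre

/-- Euclidean space `ℝ^m`. -/
abbrev Euc (m : ℕ) : Type := EuclideanSpace ℝ (Fin m)

/-! ### Oriented hypersurfaces, principal curvatures, curvature radii -/

section Hypersurface

variable {n : ℕ} {M : Type*} [TopologicalSpace M] [ChartedSpace (Euc n) M]

/-- The differential at `p` of a map from an `n`-manifold to `ℝ^m`, with the tangent spaces of `ℝ^m`
identified with `ℝ^m`. -/
def diff (n : ℕ) {m : ℕ} {M : Type*} [TopologicalSpace M] [ChartedSpace (Euc n) M]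
    (f : M → Euc m) (p : M) : TangentSpace (𝓡 n) p →ₗ[ℝ] Euc m :=
  (mfderiv (𝓡 n) 𝓘(ℝ, Euc m) f p).toLinearMap

/-- `x : M^n → ℝ^{n+1}` is a smooth immersion and `ξ` is a smooth unit normal field along it. -/
structure IsOrientedHypersurface (x ξ : M → Euc (n + 1)) : Prop where
  smooth : ContMDiff (𝓡 n) 𝓘(ℝ, Euc (n + 1)) ∞ x
  immersion : ∀ p, Function.Injective (diff n x p)
  smooth_normal : ContMDiff (𝓡 n) 𝓘(ℝ, Euc (n + 1)) ∞ ξ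
  unit : ∀ p, ‖ξ p‖ = 1
  normal : ∀ p (v : TangentSpace (𝓡 n) p), inner ℝ (ξ p) (diff n x p v) = 0

/-- The space of tangent vectors `v` at `p` with `dξ(v) = -k dx(v)`. -/
def principalSpace (x ξ : M → Euc (n + 1)) (p : M) (k : ℝ) :
    Submodule ℝ (TangentSpace (𝓡 n) p) :=
  LinearMap.ker (diff n ξ p + k • diff n x p)

/-- The set of the (pairwise distinct) principal curvatures at `p`. -/
def principalCurvatures (x ξ : M → Euc (n + 1)) (p : M) : Set ℝ :=
  {k | ∃ v : TangentSpace (𝓡 n) p, v ≠ 0 ∧ diff n ξ p v = -(k • diff n x p v)}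

/-- `p` is an umbilic point: all principal curvatures at `p` coincide. -/
def IsUmbilic (x ξ : M → Euc (n + 1)) (p : M) : Prop :=
  ∃ k : ℝ, ∀ v : TangentSpace (𝓡 n) p, diff n ξ p v = -(k • diff n x p v)

/-- The multiplicity of `k` as a principal curvature at `p` (zero if `k` is not one). -/
def multiplicity (x ξ : M → Euc (n + 1)) (p : M) (k : ℝ) : ℕ :=
  Module.finrank ℝ (principalSpace x ξ p k)

/-- The mean radius of curvature `r = (r₁ + ⋯ + rₙ) / n`, `rᵢ = 1 / kᵢ`, where every principal
curvature is counted with its multiplicity. -/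
def meanRadius (x ξ : M → Euc (n + 1)) (p : M) : ℝ :=
  (∑ᶠ k : ℝ, (multiplicity x ξ p k : ℝ) * (1 / k)) / n

/-- `ρ = √(∑ᵢ (r - rᵢ)²)`, with multiplicities. -/
def rho (x ξ : M → Euc (n + 1)) (p : M) : ℝ :=
  √(∑ᶠ k : ℝ, (multiplicity x ξ p k : ℝ) * (meanRadius x ξ p - 1 / k) ^ 2)

end Hypersurface

/-! ### The space `ℝ^{n+4}_2` and the maps `y`, `Y`, `η` -/

/-- `ℝ^{n+4}`, written as `ℝ × ℝ × ℝ^{n+1} × ℝ`. -/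
abbrev Amb (n : ℕ) : Type := ℝ × ℝ × Euc (n + 1) × ℝ

/-- The inner product `-X₁Y₁ + X₂Y₂ + ⋯ + X_{n+3}Y_{n+3} - X_{n+4}Y_{n+4}`. -/
def form {n : ℕ} (X Y : Amb n) : ℝ :=
  -(X.1 * Y.1) + X.2.1 * Y.2.1 + inner ℝ X.2.2.1 Y.2.2.1 - X.2.2.2 * Y.2.2.2

/-- `y = (x·ξ, -x·ξ, ξ, 1)`. -/
def yMap {n : ℕ} {M : Type*} (x ξ : M → Euc (n + 1)) (p : M) : Amb n :=
  (inner ℝ (x p) (ξ p), -inner ℝ (x p) (ξ p), ξ p, 1)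

section Maps

variable {n : ℕ} {M : Type*} [TopologicalSpace M] [ChartedSpace (Euc n) M]

/-- The Laguerre position vector `Y = ρ y`. -/
def position (x ξ : M → Euc (n + 1)) (p : M) : Amb n :=
  rho x ξ p • yMap x ξ p

/-- The Laguerre normal map `η = ((1 + |x|²)/2, (1 - |x|²)/2, x, 0) + r (x·ξ, -x·ξ, ξ, 1)`. -/
def normalMap (x ξ : M → Euc (n + 1)) (p : M) : Amb n :=
  (((1 + ‖x p‖ ^ 2) / 2, (1 - ‖x p‖ ^ 2) / 2, x p, 0) : Amb n) + meanRadius x ξ p • yMap x ξ p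

end Maps

/-! ### Calculus in coordinates -/

/-- The `i`-th partial derivative. -/
def pd {n : ℕ} {F : Type*} [NormedAddCommGroup F] [NormedSpace ℝ F] (i : Fin n) (f : Euc n → F)
    (u : Euc n) : F :=
  fderiv ℝ f u (EuclideanSpace.single i 1)

/-- The Laplacian `Δ_G f = (det G)^{-1/2} ∑ᵢ ∂ᵢ ((det G)^{1/2} ∑ⱼ G^{ij} ∂ⱼ f)` of the Riemannian
metric with coefficient matrix `G`. -/
def laplacian {n : ℕ} {F : Type*} [NormedAddCommGroup F] [NormedSpace ℝ F]
    (G : Euc n → Matrix (Fin n) (Fin n) ℝ) (f : Euc n → F) (u : Euc n) : F :=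
  (√((G u).det))⁻¹ •
    ∑ i, pd i (fun w => √((G w).det) • ∑ j, ((G w)⁻¹ i j) • pd j f w) u

/-! ### The Laguerre metric and the Laguerre invariants in a chart `φ` -/

section Invariants

variable {n : ℕ} {M : Type*} [TopologicalSpace M] [ChartedSpace (Euc n) M]

/-- The coefficients `g_{ij} = ρ² ⟨∂ᵢ y, ∂ⱼ y⟩` of the Laguerre metric `g = ρ² III`. -/
def metric (x ξ : M → Euc (n + 1)) (φ : OpenPartialHomeomorph M (Euc n)) (u : Euc n) :
    Matrix (Fin n) (Fin n) ℝ :=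
  Matrix.of fun i j =>
    rho x ξ (φ.symm u) ^ 2 * form (pd i (yMap x ξ ∘ φ.symm) u) (pd j (yMap x ξ ∘ φ.symm) u)

/-- `Δ_g Y`. -/
def lapY (x ξ : M → Euc (n + 1)) (φ : OpenPartialHomeomorph M (Euc n)) (u : Euc n) : Amb n :=
  laplacian (metric x ξ φ) (position x ξ ∘ φ.symm) u

/-- `N = (1/n) Δ_g Y + (1/(2n²)) ⟨Δ_g Y, Δ_g Y⟩ Y`. -/
def nMap (x ξ : M → Euc (n + 1)) (φ : OpenPartialHomeomorph M (Euc n)) (u : Euc n) : Amb n :=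
  (1 / (n : ℝ)) • lapY x ξ φ u +
    (1 / (2 * (n : ℝ) ^ 2) * form (lapY x ξ φ u) (lapY x ξ φ u)) • position x ξ (φ.symm u)

/-- The coefficients `𝕃(∂ᵢ, ∂ⱼ)` of the Laguerre tensor. In the structure equation
`dN(v) = ∑ⱼ 𝕃(v, Eⱼ) dY(Eⱼ) + ℂ(v) P`, with `E` a `g`-orthonormal frame and `P = (1, -1, 0, 0)`,
the pairing with `dY(w)`, which is orthogonal to `P`, gives `𝕃(v, w) = ⟨dN(v), dY(w)⟩`. -/
def laguerreTensor (x ξ : M → Euc (n + 1)) (φ : OpenPartialHomeomorph M (Euc n)) (u : Euc n) :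
    Matrix (Fin n) (Fin n) ℝ :=
  Matrix.of fun i j => form (pd i (nMap x ξ φ) u) (pd j (position x ξ ∘ φ.symm) u)

/-- The coefficients `ℂ(∂ᵢ)` of the Laguerre form. Pairing the same structure equation with `η`,
where `⟨η, P⟩ = -1` and `⟨η, dY⟩ = 0`, gives `ℂ(v) = -⟨dN(v), η⟩`. -/
def laguerreForm (x ξ : M → Euc (n + 1)) (φ : OpenPartialHomeomorph M (Euc n)) (u : Euc n)
    (i : Fin n) : ℝ :=
  -form (pd i (nMap x ξ φ) u) (normalMap x ξ (φ.symm u))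

/-- `x` (with unit normal `ξ`) is an L-isotropic hypersurface with constant `lam`: there are no
umbilic points, no principal curvature vanishes, `ℂ = 0`, and `𝕃 = lam • g`, that is,
`L_{ij} = lam δ_{ij}` in `g`-orthonormal frames. The tensor identities are expressed in the charts
of the atlas of `M`. -/
structure IsLIsotropic (x ξ : M → Euc (n + 1)) (lam : ℝ) : Prop where
  hypersurface : IsOrientedHypersurface x ξ
  umbilic_free : ∀ p, ¬ IsUmbilic x ξ p
  nonvanishing : ∀ p, (0 : ℝ) ∉ principalCurvatures x ξ p
  form_eq_zero : ∀ φ ∈ atlas (Euc n) M, ∀ u ∈ φ.target, ∀ i, laguerreForm x ξ φ u i = 0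
  tensor_eq : ∀ φ ∈ atlas (Euc n) M, ∀ u ∈ φ.target,
    laguerreTensor x ξ φ u = lam • metric x ξ φ u

end Invariants

end Laguerre

end

/-! The heart of the matter is local: if exactly two principal curvatures occur at every point of a
nonempty open set, then `lam = 0`. Both assertions follow. Absence of umbilics gives at least two
curvatures everywhere (`IsLIsotropic.two_le_encard`), so an open set missing the points with three
or more would have exactly two throughout, which `lam > 0` forbids.

For the local statement, `ℂ = 0` and `𝕃 = lam • g` amount to `dN = lam dY` (`dirD_N`), so `A = N -
lam Y` is a constant vector on a ball in a chart. It satisfies `⟨A, A⟩ = 2 lam`, `⟨Y, A⟩ = -1`, `⟨η,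
A⟩ = 0` and `⟨A, P⟩ = 0`. Thus `Y` maps into a hyperplane section of the light cone in the
orthogonal complement of `P`, which modulo `P` is a space form of curvature `-2 lam`. Moreover `dη =
-dY ∘ S` with no component along `Y`, where `S = (T - r) / ρ` and `T` has the radii `rᵢ` as
eigenvalues.

The normalization by `r` and `ρ` makes `S` trace-free with `tr S² = 1`. With two eigenvalues this
forces `S² = s S + 1/n`, where `s²` depends only on the multiplicities; continuity makes `s`
constant. Let `B = -⟨dη, dY⟩`. Its covariant derivative is totally symmetric (Codazzi), and
differentiating the quadratic equation together with this symmetry gives `∇B = 0` (`third_eq_zero`).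
A parallel symmetric form on a space of curvature `-2 lam` satisfies a Ricci identity,
`IsotropicPair.gauss`; on eigenvectors for the two different eigenvalues of `S` it reads `lam * (R₁
- R₂) = 0` up to a nonzero factor.

The remaining work is to verify the frame relations from the coordinate Laplacian, and to obtain
smoothness of `r` and `ρ` although the radii and multiplicities are chosen pointwise: everything
needed is a function of traces of powers of the smooth field `T`. -/

noncomputable section

namespace Laguerre

/-! ### Directional derivatives and the product rule for bilinear forms -/

section DirectionalDerivative

variable {V E F : Type*} [NormedAddCommGroup V] [NormedSpace ℝ V] [NormedAddCommGroup E]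
  [NormedSpace ℝ E] [NormedAddCommGroup F] [NormedSpace ℝ F]

/-- The derivative of `f` in the direction `v`. -/
def dirD (v : V) (f : V → E) (u : V) : E := fderiv ℝ f u v

theorem dirD_add_dir (v w : V) (f : V → E) (u : V) :
    dirD (v + w) f u = dirD v f u + dirD w f u := map_add _ _ _

theorem dirD_smul_dir (c : ℝ) (v : V) (f : V → E) (u : V) :
    dirD (c • v) f u = c • dirD v f u := map_smul _ _ _

theorem contDiffOn_dirD {Ω : Set V} (hΩ : IsOpen Ω) {f : V → E} (hf : ContDiffOn ℝ ∞ f Ω) (v : V) :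
    ContDiffOn ℝ ∞ (dirD v f) Ω :=
  (hf.fderiv_of_isOpen hΩ (m := ∞) (by simp)).clm_apply contDiffOn_const

theorem differentiableAt_of_contDiffOn {Ω : Set V} (hΩ : IsOpen Ω) {f : V → E}
    (hf : ContDiffOn ℝ ∞ f Ω) {u : V} (hu : u ∈ Ω) : DifferentiableAt ℝ f u :=
  (hf.contDiffAt (hΩ.mem_nhds hu)).differentiableAt (by simp)

theorem dirD_comm {Ω : Set V} (hΩ : IsOpen Ω) {f : V → E} (hf : ContDiffOn ℝ ∞ f Ω) {u : V}
    (hu : u ∈ Ω) (v w : V) : dirD v (dirD w f) u = dirD w (dirD v f) u := by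
  have hd : DifferentiableAt ℝ (fderiv ℝ f) u :=
    differentiableAt_of_contDiffOn hΩ (hf.fderiv_of_isOpen hΩ (m := ∞) (by simp)) hu
  have key : ∀ a c : V, dirD a (dirD c f) u = fderiv ℝ (fderiv ℝ f) u a c := by
    intro a c
    unfold dirD
    rw [fderiv_clm_apply hd (differentiableAt_const c)]
    simp
  rw [key, key]
  exact ((hf.contDiffAt (hΩ.mem_nhds hu)).isSymmSndFDerivAt
    (by simpa using WithTop.coe_le_coe.2 (le_top : (2 : ℕ∞) ≤ ⊤))).eq v w

theorem dirD_congr {Ω : Set V} (hΩ : IsOpen Ω) {f g : V → E} (h : ∀ w ∈ Ω, f w = g w) {u : V}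
    (hu : u ∈ Ω) (v : V) : dirD v f u = dirD v g u := by
  unfold dirD
  rw [Filter.EventuallyEq.fderiv_eq (Filter.eventuallyEq_of_mem (hΩ.mem_nhds hu) h)]

theorem dirD_eq_zero_of_const {Ω : Set V} (hΩ : IsOpen Ω) {f : V → E} {c : E}
    (h : ∀ w ∈ Ω, f w = c) {u : V} (hu : u ∈ Ω) (v : V) : dirD v f u = 0 := by
  rw [dirD_congr hΩ (g := fun _ => c) h hu]
  simp [dirD]

theorem dirD_smul {c : V → ℝ} {f : V → E} {u : V} (hc : DifferentiableAt ℝ c u)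
    (hf : DifferentiableAt ℝ f u) (v : V) :
    dirD v (fun w => c w • f w) u = c u • dirD v f u + dirD v c u • f u := by
  unfold dirD
  rw [fderiv_fun_smul hc hf]
  simp

theorem dirD_add {f g : V → E} {u : V} (hf : DifferentiableAt ℝ f u)
    (hg : DifferentiableAt ℝ g u) (v : V) :
    dirD v (fun w => f w + g w) u = dirD v f u + dirD v g u := by
  unfold dirD
  rw [fderiv_fun_add hf hg]
  simp

theorem dirD_bilin (b : E →L[ℝ] E →L[ℝ] F) {f g : V → E} {u : V} (hf : DifferentiableAt ℝ f u)
    (hg : DifferentiableAt ℝ g u) (v : V) :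
    dirD v (fun w => b (f w) (g w)) u = b (dirD v f u) (g u) + b (f u) (dirD v g u) := by
  unfold dirD
  rw [b.fderiv_of_bilinear hf hg]
  simp [add_comm]

theorem dirD_bilin_const (b : E →L[ℝ] E →L[ℝ] F) {Ω : Set V} (hΩ : IsOpen Ω) {f g : V → E}
    (hf : ContDiffOn ℝ ∞ f Ω) (hg : ContDiffOn ℝ ∞ g Ω) {c : F}
    (h : ∀ w ∈ Ω, b (f w) (g w) = c) {u : V} (hu : u ∈ Ω) (v : V) :
    b (dirD v f u) (g u) + b (f u) (dirD v g u) = 0 := by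
  rw [← dirD_bilin b (differentiableAt_of_contDiffOn hΩ hf hu)
    (differentiableAt_of_contDiffOn hΩ hg hu)]
  exact dirD_eq_zero_of_const hΩ h hu v

end DirectionalDerivative

/-! ### Parallel second fundamental forms in a hyperplane section of the light cone -/

section Core

variable {V E : Type*} [NormedAddCommGroup V] [NormedSpace ℝ V] [NormedAddCommGroup E]
  [NormedSpace ℝ E]

/-- A conformal position map `Y` and a conformal normal map `η` on an open set, with values in a
space with a symmetric bilinear form `b`, such that `Y` lies in a hyperplane `b A Y = -1`,
`dη = -dY ∘ S`, and the field `S` of endomorphisms satisfies a quadratic equation with constant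
coefficients and positive discriminant. -/
structure IsotropicPair (b : E →L[ℝ] E →L[ℝ] ℝ) (Ω : Set V) (Y η : V → E) (A P : E)
    (S : V → V →ₗ[ℝ] V) (lam s t : ℝ) : Prop where
  symm : ∀ X Z, b X Z = b Z X
  isOpen : IsOpen Ω
  smooth_Y : ContDiffOn ℝ ∞ Y Ω
  smooth_η : ContDiffOn ℝ ∞ η Ω
  AA : b A A = 2 * lam
  YY : ∀ u ∈ Ω, b (Y u) (Y u) = 0
  YA : ∀ u ∈ Ω, b (Y u) A = -1
  YP : ∀ u ∈ Ω, b (Y u) P = 0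
  AP : b A P = 0
  ηY : ∀ u ∈ Ω, b (η u) (Y u) = 0
  ηP : ∀ u ∈ Ω, b (η u) P = -1
  ηA : ∀ u ∈ Ω, b (η u) A = 0
  ηdY : ∀ u ∈ Ω, ∀ v, b (η u) (dirD v Y u) = 0
  dη : ∀ u ∈ Ω, ∀ v, dirD v η u = -dirD (S u v) Y u
  quadratic : ∀ u ∈ Ω, ∀ v, S u (S u v) = s • S u v + t • v
  disc : s ^ 2 / 4 + t ≠ 0
  span : ∀ u ∈ Ω, ∀ W, b W (Y u) = 0 → b W A = 0 → b W P = 0 →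
    ∃ v, ∃ c : ℝ, W = dirD v Y u + c • P

namespace IsotropicPair

variable {b : E →L[ℝ] E →L[ℝ] ℝ} {Ω : Set V} {Y η : V → E} {A P : E} {S : V → V →ₗ[ℝ] V}
  {lam s t : ℝ}

theorem dY_Y (h : IsotropicPair b Ω Y η A P S lam s t) {u : V} (hu : u ∈ Ω) (i : V) :
    b (dirD i Y u) (Y u) = 0 := by
  have := dirD_bilin_const b h.isOpen h.smooth_Y h.smooth_Y h.YY hu i
  rw [h.symm (Y u)] at this
  linarith

theorem dY_const (h : IsotropicPair b Ω Y η A P S lam s t) {f : V → E} (hf : ContDiffOn ℝ ∞ f Ω)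
    {Q : E} {c : ℝ} (hc : ∀ u ∈ Ω, b (f u) Q = c) {u : V} (hu : u ∈ Ω) (i : V) :
    b (dirD i f u) Q = 0 := by
  have := dirD_bilin_const b h.isOpen hf (g := fun _ => Q) contDiffOn_const hc hu i
  simpa [dirD] using this

theorem dη_Y (h : IsotropicPair b Ω Y η A P S lam s t) {u : V} (hu : u ∈ Ω) (i : V) :
    b (dirD i η u) (Y u) = 0 := by
  have := dirD_bilin_const b h.isOpen h.smooth_η h.smooth_Y h.ηY hu i
  rwa [h.ηdY u hu, add_zero] at this

/-- Differentiating `⟨η, dY⟩ = 0` turns each side into minus the pairing of `η` with the symmetric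
Hessian of `Y`. -/
theorem dη_dY_symm (h : IsotropicPair b Ω Y η A P S lam s t) {u : V} (hu : u ∈ Ω) (i k : V) :
    b (dirD i η u) (dirD k Y u) = b (dirD k η u) (dirD i Y u) := by
  have sY := contDiffOn_dirD h.isOpen h.smooth_Y
  have h1 := dirD_bilin_const b h.isOpen h.smooth_η (sY k) (fun w hw => h.ηdY w hw k) hu i
  have h2 := dirD_bilin_const b h.isOpen h.smooth_η (sY i) (fun w hw => h.ηdY w hw i) hu k
  rw [dirD_comm h.isOpen h.smooth_Y hu k i] at h2
  linarith

/-- The covariant derivative of the conformal second fundamental form `-b (dη ·) (dY ·)`. -/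
def third (b : E →L[ℝ] E →L[ℝ] ℝ) (Y η : V → E) (u i j k : V) : ℝ :=
  b (dirD k η u) (dirD i (dirD j Y) u) - b (dirD i (dirD j η) u) (dirD k Y u)

theorem third_comm₁₂ (h : IsotropicPair b Ω Y η A P S lam s t) {u : V} (hu : u ∈ Ω) (i j k : V) :
    third b Y η u i j k = third b Y η u j i k := by
  unfold third
  rw [dirD_comm h.isOpen h.smooth_Y hu i j, dirD_comm h.isOpen h.smooth_η hu i j]

/-- Codazzi equation: it is the derivative of the symmetry `dη_dY_symm`. With `third_comm₁₂` it
makes `third` totally symmetric. -/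
theorem third_comm₁₃ (h : IsotropicPair b Ω Y η A P S lam s t) {u : V} (hu : u ∈ Ω) (i j k : V) :
    third b Y η u i j k = third b Y η u k j i := by
  have sY := contDiffOn_dirD h.isOpen h.smooth_Y
  have sη := contDiffOn_dirD h.isOpen h.smooth_η
  have dYd := fun v => differentiableAt_of_contDiffOn h.isOpen (sY v) hu
  have dηd := fun v => differentiableAt_of_contDiffOn h.isOpen (sη v) hu
  have e := dirD_congr h.isOpen (f := fun w => b (dirD i η w) (dirD k Y w))
    (g := fun w => b (dirD k η w) (dirD i Y w)) (fun w hw => h.dη_dY_symm hw i k) hu j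
  rw [dirD_bilin b (dηd i) (dYd k), dirD_bilin b (dηd k) (dYd i)] at e
  unfold third
  rw [dirD_comm h.isOpen h.smooth_Y hu i j, dirD_comm h.isOpen h.smooth_η hu i j,
    dirD_comm h.isOpen h.smooth_Y hu k j, dirD_comm h.isOpen h.smooth_η hu k j]
  linarith

theorem third_add (u i j k l : V) :
    third b Y η u i j (k + l) = third b Y η u i j k + third b Y η u i j l := by
  simp only [third, dirD_add_dir, map_add, add_apply]
  ring

theorem third_smul (u i j k : V) (c : ℝ) :
    third b Y η u i j (c • k) = c * third b Y η u i j k := by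
  simp only [third, dirD_smul_dir, map_smul, smul_apply, smul_eq_mul]
  ring

/-- The left side is the form of `S²`, so this is the quadratic equation for `S` lowered to bilinear
forms, where it can be differentiated without any regularity of `S`. -/
theorem b_dη_dη (h : IsotropicPair b Ω Y η A P S lam s t) {u : V} (hu : u ∈ Ω) (i k : V) :
    b (dirD i η u) (dirD k η u) =
      -s * b (dirD i η u) (dirD k Y u) + t * b (dirD i Y u) (dirD k Y u) := by
  have e1 : b (dirD i η u) (dirD k η u) = b (dirD i Y u) (dirD (S u (S u k)) Y u) := by
    rw [h.dη u hu k, map_neg, h.dη_dY_symm hu, h.dη u hu (S u k), map_neg, neg_apply, neg_neg,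
      h.symm]
  have e2 : b (dirD i Y u) (dirD (S u k) Y u) = - b (dirD i η u) (dirD k Y u) := by
    rw [h.dη_dY_symm hu, h.dη u hu k, map_neg, neg_apply, neg_neg, h.symm]
  rw [e1, h.quadratic u hu, dirD_add_dir, dirD_smul_dir, dirD_smul_dir, map_add, map_smul,
    map_smul, e2]
  simp

/-- Covariant derivative of `S² = s S + t`, that is `(∇S) S + S (∇S) = s ∇S`. The `t` term drops out
because the metric is parallel. -/
theorem third_quadratic (h : IsotropicPair b Ω Y η A P S lam s t) {u : V} (hu : u ∈ Ω)
    (i j k : V) :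
    third b Y η u i j (S u k) + third b Y η u k j (S u i) = s * third b Y η u i j k := by
  have sY := contDiffOn_dirD h.isOpen h.smooth_Y
  have sη := contDiffOn_dirD h.isOpen h.smooth_η
  have dYd := fun v => differentiableAt_of_contDiffOn h.isOpen (sY v) hu
  have dηd := fun v => differentiableAt_of_contDiffOn h.isOpen (sη v) hu
  have hB := dirD_bilin b (dηd i) (dYd k) j
  have hg := dirD_bilin b (dYd i) (dYd k) j
  have e := dirD_congr h.isOpen (f := fun w => b (dirD i η w) (dirD k η w))
    (g := fun w => -s * b (dirD i η w) (dirD k Y w) + t * b (dirD i Y w) (dirD k Y w))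
    (fun w hw => h.b_dη_dη hw i k) hu j
  have hd1 : DifferentiableAt ℝ (fun w => b (dirD i η w) (dirD k Y w)) u :=
    (b.differentiableAt.comp u (dηd i)).clm_apply (dYd k)
  have hd2 : DifferentiableAt ℝ (fun w => b (dirD i Y w) (dirD k Y w)) u :=
    (b.differentiableAt.comp u (dYd i)).clm_apply (dYd k)
  have e' : dirD j (fun w => -s * b (dirD i η w) (dirD k Y w) + t * b (dirD i Y w) (dirD k Y w)) u
      = -s * dirD j (fun w => b (dirD i η w) (dirD k Y w)) u
        + t * dirD j (fun w => b (dirD i Y w) (dirD k Y w)) u := by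
    unfold dirD at hd1 hd2 ⊢
    rw [fderiv_fun_add (hd1.const_mul _) (hd2.const_mul _), fderiv_const_mul hd1,
      fderiv_const_mul hd2]
    simp
  rw [e', hB, hg, dirD_bilin b (dηd i) (dηd k)] at e
  have key : ∀ a X, b (dirD (S u a) η u) X = s * b (dirD a η u) X - t * b (dirD a Y u) X := by
    intro a X
    rw [h.dη u hu (S u a), h.quadratic u hu, h.dη u hu a, dirD_add_dir, dirD_smul_dir,
      dirD_smul_dir]
    simp
    ring
  have k1 := key k (dirD j (dirD i Y) u)
  have k2 := key i (dirD j (dirD k Y) u)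
  have m1 : b (dirD j (dirD i η) u) (dirD (S u k) Y u)
      = - b (dirD j (dirD i η) u) (dirD k η u) := by
    rw [h.dη u hu k]; simp
  have m2 : b (dirD j (dirD k η) u) (dirD (S u i) Y u)
      = - b (dirD i η u) (dirD j (dirD k η) u) := by
    rw [h.symm (dirD i η u), h.dη u hu i]; simp
  unfold third
  rw [dirD_comm h.isOpen h.smooth_Y hu i j, dirD_comm h.isOpen h.smooth_η hu i j,
    dirD_comm h.isOpen h.smooth_Y hu k j, dirD_comm h.isOpen h.smooth_η hu k j, k1, k2, m1, m2]
  have n1 := h.symm (dirD j (dirD i Y) u) (dirD k Y u)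
  have c := h.third_comm₁₃ hu i j k
  unfold third at c
  rw [dirD_comm h.isOpen h.smooth_Y hu i j, dirD_comm h.isOpen h.smooth_η hu i j,
    dirD_comm h.isOpen h.smooth_Y hu k j, dirD_comm h.isOpen h.smooth_η hu k j] at c
  linear_combination e + t * n1

/-- By total symmetry, the values of `third` with `S` inserted in one of the three slots have
pairwise sums `s * third`, so each equals `s / 2 * third`. Inserting `S` twice and using the
quadratic equation then gives `(s² / 4 + t) * third = 0`. -/
theorem third_eq_zero (h : IsotropicPair b Ω Y η A P S lam s t) {u : V} (hu : u ∈ Ω)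
    (i j k : V) : third b Y η u i j k = 0 := by
  have half : ∀ i j k, third b Y η u i j (S u k) = s / 2 * third b Y η u i j k := by
    intro i j k
    have q1 := h.third_quadratic hu i j k
    have q2 := h.third_quadratic hu j i k
    have q3 := h.third_quadratic hu i k j
    have a1 := h.third_comm₁₂ hu j i (S u k)
    have a2 := h.third_comm₁₂ hu k j (S u i)
    have a3 := h.third_comm₁₂ hu i k (S u j)
    have a4 : third b Y η u j i k = third b Y η u i j k := h.third_comm₁₂ hu j i k
    have a5 : third b Y η u i k j = third b Y η u i j k := by
      rw [h.third_comm₁₂ hu i k, h.third_comm₁₃ hu k i j, a4]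
    rw [a4] at q2
    rw [a5] at q3
    linarith
  have e1 := half i j (S u k)
  rw [h.quadratic u hu, third_add, third_smul, third_smul, half i j k] at e1
  have : (s ^ 2 / 4 + t) * third b Y η u i j k = 0 := by linarith
  exact (mul_eq_zero.1 this).resolve_left h.disc

/-- The Gauss equation for a parallel conformal second fundamental form. -/
theorem gauss (h : IsotropicPair b Ω Y η A P S lam s t) {u : V} (hu : u ∈ Ω) (i k : V) :
    lam * (b (dirD k η u) (dirD k Y u) * b (dirD i Y u) (dirD i Y u)) =
      lam * (b (dirD i η u) (dirD i Y u) * b (dirD k Y u) (dirD k Y u)) := by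
  have sY := contDiffOn_dirD h.isOpen h.smooth_Y
  have sη := contDiffOn_dirD h.isOpen h.smooth_η
  have sYY := fun v w => contDiffOn_dirD h.isOpen (sY v) w
  have sηη := fun v w => contDiffOn_dirD h.isOpen (sη v) w
  have dYd := fun v => differentiableAt_of_contDiffOn h.isOpen (sY v) hu
  have dηd := fun v => differentiableAt_of_contDiffOn h.isOpen (sη v) hu
  have dYYd := fun v w => differentiableAt_of_contDiffOn h.isOpen (sYY v w) hu
  have dηηd := fun v w => differentiableAt_of_contDiffOn h.isOpen (sηη v w) hu
  -- differentiate the vanishing of `third`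
  have ricci : ∀ i j k l,
      b (dirD l (dirD k η) u) (dirD j (dirD i Y) u) + b (dirD k η u) (dirD l (dirD j (dirD i Y)) u)
      = b (dirD l (dirD j (dirD i η)) u) (dirD k Y u)
        + b (dirD j (dirD i η) u) (dirD l (dirD k Y) u) := by
    intro i j k l
    rw [← dirD_bilin b (dηd k) (dYYd i j), ← dirD_bilin b (dηηd i j) (dYd k)]
    refine dirD_congr h.isOpen (fun w hw => ?_) hu l
    have := h.third_eq_zero hw j i k
    unfold third at this
    linarith
  have dA : ∀ f : V → E, ContDiffOn ℝ ∞ f Ω → ∀ Q c, (∀ u ∈ Ω, b (f u) Q = c) →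
      ∀ v w, b (dirD v (dirD w f) u) Q = 0 := fun f hf Q c hc v w =>
    h.dY_const (contDiffOn_dirD h.isOpen hf w) (fun u hu => h.dY_const hf hc hu w) hu v
  -- `ν` is the normal direction of the second derivatives of `Y`: it pairs to `-1` with `Y` and to
  -- `0` with `A` and `P`, so subtracting a multiple of it brings these derivatives within reach of
  -- `span`.
  obtain ⟨ν, hν⟩ : ∃ ν : E, ν = (2 * lam) • Y u + A := ⟨_, rfl⟩
  have νY : b ν (Y u) = -1 := by
    simp only [hν, map_add, map_smul, add_apply, smul_apply, h.YY u hu, h.symm A, h.YA u hu]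
    simp
  have νA : b ν A = 0 := by
    simp only [hν, map_add, map_smul, add_apply, smul_apply, h.YA u hu, h.AA]
    simp
  have νP : b ν P = 0 := by
    simp only [hν, map_add, map_smul, add_apply, smul_apply, h.YP u hu, h.AP]
    simp
  have YYY : ∀ i j, b (dirD j (dirD i Y) u) (Y u) = - b (dirD i Y u) (dirD j Y u) := by
    intro i j
    have := dirD_bilin_const b h.isOpen (sY i) h.smooth_Y (fun w hw => h.dY_Y hw i) hu j
    linarith
  have ηηY : ∀ i j, b (dirD j (dirD i η) u) (Y u) = - b (dirD i η u) (dirD j Y u) := by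
    intro i j
    have := dirD_bilin_const b h.isOpen (sη i) h.smooth_Y (fun w hw => h.dη_Y hw i) hu j
    linarith
  have ην : ∀ i, b (dirD i η u) ν = 0 := by
    intro i
    rw [hν, map_add, map_smul, h.dη_Y hu, h.dY_const h.smooth_η h.ηA hu]
    simp
  -- tangential part of the second derivatives of `Y`
  have tang : ∀ i j, ∃ v, ∃ c : ℝ, dirD j (dirD i Y) u =
      b (dirD i Y u) (dirD j Y u) • ν + (dirD v Y u + c • P) := by
    intro i j
    obtain ⟨v, c, hv⟩ := h.span u hu
      (dirD j (dirD i Y) u - b (dirD i Y u) (dirD j Y u) • ν) (by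
        rw [map_sub, sub_apply, map_smul, smul_apply, νY, YYY]; simp) (by
        rw [map_sub, sub_apply, map_smul, smul_apply, νA, dA Y h.smooth_Y A (-1) h.YA]; simp) (by
        rw [map_sub, sub_apply, map_smul, smul_apply, νP, dA Y h.smooth_Y P 0 h.YP]; simp)
    exact ⟨v, c, by rw [← hv]; abel⟩
  have ηην : ∀ i j, b (dirD j (dirD i η) u) ν = - (2 * lam) * b (dirD i η u) (dirD j Y u) := by
    intro i j
    rw [hν, map_add, map_smul, ηηY, dA η h.smooth_η A 0 h.ηA]
    simp
  -- Only the tangential parts `v`, `w` of the two second derivatives of `Y` contribute beyond the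
  -- `lam` terms, through `⟨dη(v), dY(w)⟩`, which is symmetric in `v` and `w`.
  have swap : ∀ i j k l, b (dirD l (dirD k η) u) (dirD j (dirD i Y) u)
      + 2 * lam * (b (dirD k η u) (dirD l Y u) * b (dirD i Y u) (dirD j Y u))
      = b (dirD j (dirD i η) u) (dirD l (dirD k Y) u)
      + 2 * lam * (b (dirD i η u) (dirD j Y u) * b (dirD k Y u) (dirD l Y u)) := by
    intro i j k l
    obtain ⟨v, c, hv⟩ := tang i j
    obtain ⟨w, d, hw⟩ := tang k l
    have ex : ∀ (k l i j v : V) (c : ℝ), dirD j (dirD i Y) u =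
        b (dirD i Y u) (dirD j Y u) • ν + (dirD v Y u + c • P) →
        b (dirD l (dirD k η) u) (dirD j (dirD i Y) u)
        + 2 * lam * (b (dirD k η u) (dirD l Y u) * b (dirD i Y u) (dirD j Y u)) =
        b (dirD v η u) (dirD l (dirD k Y) u) := by
      intro k l i j v c hv
      have t0 := h.third_eq_zero hu l k v
      unfold third at t0
      rw [hv, map_add, map_smul, map_add, map_smul, ηην, dA η h.smooth_η P (-1) h.ηP]
      simp only [smul_eq_mul]
      linarith
    rw [ex k l i j v c hv, ex i j k l w d hw, hv, hw]
    simp only [map_add, map_smul, ην, h.dY_const h.smooth_η h.ηP hu]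
    rw [h.dη_dY_symm hu v w]
    simp
  -- `r1` and `r2` contain the same third derivatives in different orders; subtracting them leaves
  -- products of second derivatives, which `swap` evaluates.
  have r1 := ricci i i k k
  have r2 := ricci i k k i
  have s1 := swap i i k k
  have s2 := swap i k k i
  have c1 : dirD k (dirD i (dirD i Y)) u = dirD i (dirD k (dirD i Y)) u :=
    dirD_comm h.isOpen (sY i) hu k i
  have c2 : dirD k (dirD i (dirD i η)) u = dirD i (dirD k (dirD i η)) u :=
    dirD_comm h.isOpen (sη i) hu k i
  rw [c1, c2] at r1
  have e1 := h.dη_dY_symm hu i k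
  have e2 := h.symm (dirD i Y u) (dirD k Y u)
  rw [e1, e2] at s2
  linarith

end IsotropicPair
end Core

/-! ### Linear algebra of the radius operator -/

section ShapeOperator

variable {V E : Type*} [AddCommGroup V] [Module ℝ V] [NormedAddCommGroup E]
  [InnerProductSpace ℝ E]

theorem range_eq_orthogonal_of_injective [FiniteDimensional ℝ E] {Ξ : V →ₗ[ℝ] E} {ν : E}
    (hdim : Module.finrank ℝ E = Module.finrank ℝ V + 1) (hν : ν ≠ 0)
    (hinj : Function.Injective Ξ) (horth : ∀ v, inner ℝ ν (Ξ v) = 0) :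
    LinearMap.range Ξ = (ℝ ∙ ν)ᗮ := by
  apply Submodule.eq_of_le_of_finrank_eq
  · rintro _ ⟨v, rfl⟩
    exact Submodule.mem_orthogonal_singleton_iff_inner_right.2 (horth v)
  · have h1 := LinearMap.finrank_range_of_inj hinj
    have h2 := Submodule.finrank_add_finrank_orthogonal (ℝ ∙ ν)
    rw [finrank_span_singleton hν] at h2
    omega

/-- Both maps take values in the hyperplane orthogonal to `ν`, and by dimension the injective `Ξ`
fills it, so `-X` factors through `Ξ`. -/
theorem exists_radiusOperator [FiniteDimensional ℝ E] {X Ξ : V →ₗ[ℝ] E} {ν : E}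
    (hdim : Module.finrank ℝ E = Module.finrank ℝ V + 1) (hν : ν ≠ 0)
    (hinj : Function.Injective Ξ) (hΞ : ∀ v, inner ℝ ν (Ξ v) = 0)
    (hX : ∀ v, inner ℝ ν (X v) = 0) :
    ∃ T : V →ₗ[ℝ] V, ∀ v, X v = -Ξ (T v) := by
  have hr := range_eq_orthogonal_of_injective hdim hν hinj hΞ
  let e := LinearEquiv.ofInjective Ξ hinj
  have hm : ∀ v, -X v ∈ LinearMap.range Ξ := fun v => by
    rw [hr, Submodule.mem_orthogonal_singleton_iff_inner_right]
    simp [hX]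
  refine ⟨e.symm.toLinearMap ∘ₗ LinearMap.codRestrict _ (-X) hm, fun v => ?_⟩
  have : Ξ (e.symm ⟨-X v, hm v⟩) = -X v := by
    simp [e]
  simp only [LinearMap.coe_comp, LinearEquiv.coe_coe, Function.comp_apply]
  change X v = -Ξ (e.symm ⟨-X v, hm v⟩)
  rw [this, neg_neg]

/-- An operator that is symmetric for a pulled-back inner product and has at most the eigenvalues
`R₁`, `R₂` is annihilated by `(t - R₁) (t - R₂)`. -/
theorem quadratic_of_eigenvalues [FiniteDimensional ℝ V] {Ξ : V →ₗ[ℝ] E} (hinj : Function.Injective Ξ) {T : V →ₗ[ℝ] V}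
    (hT : ∀ v w, inner ℝ (Ξ (T v)) (Ξ w) = inner ℝ (Ξ v) (Ξ (T w))) {R₁ R₂ : ℝ}
    (hR : ∀ R v, v ≠ 0 → T v = R • v → R = R₁ ∨ R = R₂) (v : V) :
    T (T v) = (R₁ + R₂) • T v - (R₁ * R₂) • v := by
  let e := LinearEquiv.ofInjective Ξ hinj
  let T' : LinearMap.range Ξ →ₗ[ℝ] LinearMap.range Ξ := e.toLinearMap ∘ₗ T ∘ₗ e.symm.toLinearMap
  have hT'e : ∀ v, T' (e v) = e (T v) := fun v => by simp [T']
  have hsymm : T'.IsSymmetric := by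
    intro a c
    obtain ⟨v, rfl⟩ := e.surjective a
    obtain ⟨w, rfl⟩ := e.surjective c
    rw [hT'e, hT'e]
    exact hT v w
  let Q : V →ₗ[ℝ] V := T ∘ₗ T - (R₁ + R₂) • T + (R₁ * R₂) • LinearMap.id
  let Q' : LinearMap.range Ξ →ₗ[ℝ] LinearMap.range Ξ :=
    e.toLinearMap ∘ₗ Q ∘ₗ e.symm.toLinearMap
  have hker : ⨆ μ, Module.End.eigenspace T' μ ≤ LinearMap.ker Q' := by
    refine iSup_le fun μ a ha => ?_
    obtain ⟨v, rfl⟩ := e.surjective a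
    rw [Module.End.mem_eigenspace_iff, hT'e, ← map_smul] at ha
    have hv := e.injective ha
    by_cases h0 : v = 0
    · simp [h0]
    have hQ : Q v = 0 := by
      simp only [Q, LinearMap.add_apply, LinearMap.sub_apply, LinearMap.comp_apply,
        LinearMap.smul_apply, LinearMap.id_apply, hv, map_smul]
      rw [smul_smul, smul_smul, ← sub_smul, ← add_smul]
      have : μ * μ - (R₁ + R₂) * μ + R₁ * R₂ = 0 := by
        rcases hR μ v h0 hv with h | h <;> subst h <;> ring
      rw [this, zero_smul]
    simp [Q', hQ]
  -- Transported to the range of `Ξ`, the operator is symmetric for the genuine inner product, so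
  -- the spectral theorem makes its eigenspaces span.
  have htop : ⨆ μ, Module.End.eigenspace T' μ = ⊤ :=
    Submodule.orthogonal_eq_bot_iff.mp hsymm.orthogonalComplement_iSup_eigenspaces_eq_bot
  have hv : Q' (e v) = 0 := hker (htop ▸ Submodule.mem_top)
  have hQv : Q v = 0 := by simpa [Q'] using hv
  simp only [Q, LinearMap.add_apply, LinearMap.sub_apply, LinearMap.comp_apply,
        LinearMap.smul_apply, LinearMap.id_apply] at hQv
  rw [← sub_eq_zero, ← hQv]
  abel

/-- `(T - R₂) / (R₁ - R₂)` is a projection onto the eigenspace of `R₁`, and the trace of a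
projection is its rank. -/
theorem trace_of_quadratic [FiniteDimensional ℝ V] {T : V →ₗ[ℝ] V} {R₁ R₂ : ℝ} (hne : R₁ ≠ R₂)
    (hq : ∀ v, T (T v) = (R₁ + R₂) • T v - (R₁ * R₂) • v) :
    LinearMap.trace ℝ V T =
      Module.finrank ℝ V * R₂ + (R₁ - R₂) * Module.finrank ℝ (Module.End.eigenspace T R₁) := by
  have hne' : R₁ - R₂ ≠ 0 := sub_ne_zero.2 hne
  let p : V →ₗ[ℝ] V := (R₁ - R₂)⁻¹ • (T - R₂ • LinearMap.id)
  have hp : LinearMap.IsProj (Module.End.eigenspace T R₁) p := by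
    constructor
    · intro v
      rw [Module.End.mem_eigenspace_iff]
      simp only [p, LinearMap.smul_apply, LinearMap.sub_apply, LinearMap.id_apply, map_smul,
        map_sub, hq]
      rw [smul_comm R₁]
      congr 1
      rw [smul_sub, smul_smul, add_smul]
      abel
    · intro v hv
      rw [Module.End.mem_eigenspace_iff] at hv
      simp only [p, LinearMap.smul_apply, LinearMap.sub_apply, LinearMap.id_apply, hv]
      rw [← sub_smul, smul_smul, inv_mul_cancel₀ hne', one_smul]
  have h := hp.trace
  have hT : T = R₂ • LinearMap.id + (R₁ - R₂) • p := by
    simp only [p]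
    rw [smul_smul, mul_inv_cancel₀ hne', one_smul]
    abel
  conv_lhs => rw [hT]
  rw [map_add, map_smul, map_smul, h, LinearMap.trace_id]
  simp [mul_comm]

/-- The data of the radius operator `T` at a point with exactly two principal curvatures: two
radii `R₁`, `R₂` with multiplicities `m₁`, `m₂`. -/
structure TwoRadii (T : V →ₗ[ℝ] V) (R₁ R₂ : ℝ) (m₁ m₂ : ℕ) : Prop where
  ne : R₁ ≠ R₂
  quadratic : ∀ v, T (T v) = (R₁ + R₂) • T v - (R₁ * R₂) • v
  pos₁ : 0 < m₁
  pos₂ : 0 < m₂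
  add : m₁ + m₂ = Module.finrank ℝ V
  trace : LinearMap.trace ℝ V T = m₁ * R₁ + m₂ * R₂
  exists₁ : ∃ v, v ≠ 0 ∧ T v = R₁ • v
  exists₂ : ∃ v, v ≠ 0 ∧ T v = R₂ • v

/-- The radii are the reciprocals of the two curvatures. An arbitrary weight `f` is allowed so that
one formula evaluates both the sum defining `meanRadius` and the one defining `rho`. -/
theorem exists_twoRadii [FiniteDimensional ℝ V] {X Ξ : V →ₗ[ℝ] E} (hinj : Function.Injective Ξ)
    (hXinj : Function.Injective X) {T : V →ₗ[ℝ] V}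
    (hXT : ∀ v, X v = -Ξ (T v)) (hsymm : ∀ v w, inner ℝ (Ξ v) (X w) = inner ℝ (X v) (Ξ w))
    (h2 : {k : ℝ | ∃ v : V, v ≠ 0 ∧ Ξ v = -(k • X v)}.encard = 2) :
    ∃ (R₁ R₂ : ℝ) (m₁ m₂ : ℕ), TwoRadii T R₁ R₂ m₁ m₂ ∧
      ∀ f : ℝ → ℝ, ∑ᶠ k : ℝ, (Module.finrank ℝ (LinearMap.ker (Ξ + k • X)) : ℝ) * f (1 / k) =
        m₁ * f R₁ + m₂ * f R₂ := by
  obtain ⟨k₁, k₂, hne, hset⟩ := Set.encard_eq_two.1 h2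
  have hiff : ∀ (k : ℝ) (v : V), Ξ v = -(k • X v) ↔ v = k • T v := by
    intro k v
    rw [hXT, smul_neg, neg_neg, ← map_smul]
    exact hinj.eq_iff
  have hk0 : ∀ k ∈ {k : ℝ | ∃ v : V, v ≠ 0 ∧ Ξ v = -(k • X v)}, k ≠ 0 := by
    rintro k ⟨v, hv, h⟩ rfl
    rw [hiff, zero_smul] at h
    exact hv h
  have hmem₁ : k₁ ∈ {k : ℝ | ∃ v : V, v ≠ 0 ∧ Ξ v = -(k • X v)} := by rw [hset]; simp
  have hmem₂ : k₂ ∈ {k : ℝ | ∃ v : V, v ≠ 0 ∧ Ξ v = -(k • X v)} := by rw [hset]; simp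
  have n₁ := hk0 _ hmem₁
  have n₂ := hk0 _ hmem₂
  have heig : ∀ (k : ℝ) (v : V), k ≠ 0 → (v = k • T v ↔ T v = (1 / k) • v) := by
    intro k v hk
    constructor
    · intro h
      conv_rhs => rw [h]
      rw [smul_smul, one_div_mul_cancel hk, one_smul]
    · intro h
      rw [h, smul_smul, mul_one_div_cancel hk, one_smul]
  have hker : ∀ k : ℝ, k ≠ 0 → LinearMap.ker (Ξ + k • X) = Module.End.eigenspace T (1 / k) := by
    intro k hk
    ext v
    rw [Module.End.mem_eigenspace_iff, ← heig k v hk, ← hiff, LinearMap.mem_ker,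
      LinearMap.add_apply, LinearMap.smul_apply, add_eq_zero_iff_eq_neg]
  have hR : ∀ (R : ℝ) (v : V), v ≠ 0 → T v = R • v → R = 1 / k₁ ∨ R = 1 / k₂ := by
    intro R v hv h
    have hR0 : R ≠ 0 := by
      rintro rfl
      apply hv
      apply hXinj
      rw [hXT, h, zero_smul, map_zero, map_zero, neg_zero]
    have : (1 / R) ∈ {k : ℝ | ∃ v : V, v ≠ 0 ∧ Ξ v = -(k • X v)} :=
      ⟨v, hv, (hiff _ _).2 ((heig _ _ (one_div_ne_zero hR0)).2 (by rw [one_div_one_div]; exact h))⟩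
    rw [hset] at this
    rcases this with h | h
    · left; rw [← h, one_div_one_div]
    · right; rw [← h, one_div_one_div]
  have hT : ∀ v w, inner ℝ (Ξ (T v)) (Ξ w) = inner ℝ (Ξ v) (Ξ (T w)) := by
    intro v w
    have := hsymm v w
    rw [hXT, hXT, inner_neg_left, inner_neg_right, neg_inj] at this
    exact this.symm
  have hq := quadratic_of_eigenvalues hinj hT hR
  have hRne : 1 / k₁ ≠ 1 / k₂ := by
    simpa using hne
  have ev : ∀ k ∈ {k : ℝ | ∃ v : V, v ≠ 0 ∧ Ξ v = -(k • X v)}, ∃ v, v ≠ 0 ∧ T v = (1 / k) • v := by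
    rintro k ⟨v, hv, h⟩
    exact ⟨v, hv, (heig k v (hk0 k ⟨v, hv, h⟩)).1 ((hiff k v).1 h)⟩
  have hpos : ∀ R, (∃ v, v ≠ 0 ∧ T v = R • v) →
      0 < Module.finrank ℝ (Module.End.eigenspace T R) := by
    rintro R ⟨v, hv, h⟩
    rw [Module.finrank_pos_iff_exists_ne_zero]
    exact ⟨⟨v, Module.End.mem_eigenspace_iff.2 h⟩, by simpa [Subtype.ext_iff] using hv⟩
  have t₁ := trace_of_quadratic hRne hq
  have t₂ := trace_of_quadratic (T := T) hRne.symm (fun v => by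
    rw [hq, add_comm (1 / k₂), mul_comm (1 / k₂)])
  have hadd : Module.finrank ℝ (Module.End.eigenspace T (1 / k₁)) +
      Module.finrank ℝ (Module.End.eigenspace T (1 / k₂)) = Module.finrank ℝ V := by
    -- The trace formula applied with the two radii in either order gives two values of `tr T`;
    -- equating them shows that the multiplicities add up to the dimension.
    have h0 : (1 / k₁ - 1 / k₂) * ((Module.finrank ℝ (Module.End.eigenspace T (1 / k₁)) : ℝ) +
      Module.finrank ℝ (Module.End.eigenspace T (1 / k₂)) - Module.finrank ℝ V) = 0 := by
      linear_combination t₂ - t₁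
    have := (mul_eq_zero.1 h0).resolve_left (sub_ne_zero.2 hRne)
    exact_mod_cast sub_eq_zero.1 this
  refine ⟨1 / k₁, 1 / k₂, Module.finrank ℝ (Module.End.eigenspace T (1 / k₁)),
    Module.finrank ℝ (Module.End.eigenspace T (1 / k₂)),
    ⟨hRne, hq, hpos _ (ev k₁ hmem₁), hpos _ (ev k₂ hmem₂), hadd, ?_, ev k₁ hmem₁, ev k₂ hmem₂⟩,
    fun f => ?_⟩
  · rw [t₁, ← hadd]
    push_cast
    ring
  · rw [finsum_eq_sum_of_support_subset (s := {k₁, k₂}), Finset.sum_pair hne, hker k₁ n₁,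
      hker k₂ n₂]
    intro k hk
    rw [Finset.coe_pair, ← hset]
    by_contra hcon
    apply hk
    have : LinearMap.ker (Ξ + k • X) = ⊥ := by
      rw [Submodule.eq_bot_iff]
      intro v hv
      by_contra hv0
      refine hcon ⟨v, hv0, ?_⟩
      rw [LinearMap.mem_ker, LinearMap.add_apply, LinearMap.smul_apply] at hv
      exact eq_neg_of_add_eq_zero_left hv
    simp [this]

/-- If there is at most one principal curvature, then all directions are principal. -/
theorem exists_umbilic_of_encard_lt_two [FiniteDimensional ℝ V] {X Ξ : V →ₗ[ℝ] E}
    (hinj : Function.Injective Ξ) (hXinj : Function.Injective X) {T : V →ₗ[ℝ] V}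
    (hXT : ∀ v, X v = -Ξ (T v)) (hsymm : ∀ v w, inner ℝ (Ξ v) (X w) = inner ℝ (X v) (Ξ w))
    (h2 : {k : ℝ | ∃ v : V, v ≠ 0 ∧ Ξ v = -(k • X v)}.encard < 2) :
    ∃ k : ℝ, ∀ v, Ξ v = -(k • X v) := by
  have hsub := Set.encard_le_one_iff.1 (Order.le_of_lt_add_one (h2.trans_eq one_add_one_eq_two.symm))
  have hR0 : ∀ (R : ℝ) (v : V), v ≠ 0 → T v = R • v → R ≠ 0 := by
    rintro R v hv h rfl
    apply hv
    apply hXinj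
    rw [hXT, h, zero_smul, map_zero, map_zero, neg_zero]
  have hmem : ∀ (R : ℝ) (v : V), R ≠ 0 → T v = R • v → Ξ v = -((1 / R) • X v) := by
    intro R v hR h
    rw [hXT, h, map_smul, smul_neg, neg_neg, smul_smul, one_div_mul_cancel hR, one_smul]
  have hT : ∀ v w, inner ℝ (Ξ (T v)) (Ξ w) = inner ℝ (Ξ v) (Ξ (T w)) := by
    intro v w
    have := hsymm v w
    rw [hXT, hXT, inner_neg_left, inner_neg_right, neg_inj] at this
    exact this.symm
  obtain ⟨R, hR⟩ : ∃ R : ℝ, ∀ (R' : ℝ) (v : V), v ≠ 0 → T v = R' • v → R' = R := by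
    by_cases hex : ∃ (R : ℝ) (v : V), v ≠ 0 ∧ T v = R • v
    · obtain ⟨R, v, hv, h⟩ := hex
      refine ⟨R, fun R' v' hv' h' => ?_⟩
      have := hsub (1 / R') (1 / R) ⟨v', hv', hmem R' v' (hR0 R' v' hv' h') h'⟩
        ⟨v, hv, hmem R v (hR0 R v hv h) h⟩
      simpa using this
    · push Not at hex
      -- Without eigenvectors the condition on `R` is vacuous, so `0` is an arbitrary choice.
      exact ⟨0, fun R' v hv h => absurd h (hex R' v hv)⟩
  have hq := quadratic_of_eigenvalues hinj hT (R₁ := R) (R₂ := R)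
    (fun R' v hv h => Or.inl (hR R' v hv h))
  have hTR : ∀ v, T v = R • v := by
    intro v
    rw [← sub_eq_zero]
    apply hinj
    rw [map_zero, ← inner_self_eq_zero (𝕜 := ℝ)]
    -- `T - R` is symmetric with square zero, hence `|Ξ((T - R) v)|² = ⟨Ξ v, Ξ((T - R)² v)⟩ = 0`.
    have e : ∀ w, inner ℝ (Ξ (T v - R • v)) (Ξ w) = inner ℝ (Ξ v) (Ξ (T w - R • w)) := by
      intro w
      simp only [map_sub, map_smul, inner_sub_left, inner_sub_right, inner_smul_left,
        inner_smul_right, hT]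
      simp
    rw [e]
    have : T (T v - R • v) - R • (T v - R • v) = 0 := by
      rw [map_sub, hq, map_smul]
      module
    rw [this, map_zero, inner_zero_right]
  refine ⟨1 / R, fun v => ?_⟩
  by_cases hv : v = 0
  · simp [hv]
  · exact hmem R v (hR0 R v hv (hTR v)) (hTR v)

namespace TwoRadii

variable {T : V →ₗ[ℝ] V} {R₁ R₂ : ℝ} {m₁ m₂ : ℕ}

/-- The sum of the squared deviations of the radii from their mean. -/
theorem sum_sq (h : TwoRadii T R₁ R₂ m₁ m₂) {r : ℝ} (hr : r = (m₁ * R₁ + m₂ * R₂) / (m₁ + m₂)) :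
    m₁ * (r - R₁) ^ 2 + m₂ * (r - R₂) ^ 2 = m₁ * m₂ / (m₁ + m₂) * (R₁ - R₂) ^ 2 := by
  have h1 : (0 : ℝ) < m₁ := by exact_mod_cast h.pos₁
  have h2 : (0 : ℝ) < m₂ := by exact_mod_cast h.pos₂
  subst hr
  field_simp
  ring

theorem trace_sq [FiniteDimensional ℝ V] (h : TwoRadii T R₁ R₂ m₁ m₂) :
    LinearMap.trace ℝ V (T ∘ₗ T) = m₁ * R₁ ^ 2 + m₂ * R₂ ^ 2 := by
  have e : T ∘ₗ T = (R₁ + R₂) • T - (R₁ * R₂) • LinearMap.id := by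
    ext v
    simp [h.quadratic]
  have hn : (Module.finrank ℝ V : ℝ) = m₁ + m₂ := by exact_mod_cast h.add.symm
  rw [e, map_sub, map_smul, map_smul, h.trace, LinearMap.trace_id, hn]
  simp only [smul_eq_mul]
  ring

theorem trace_cube [FiniteDimensional ℝ V] (h : TwoRadii T R₁ R₂ m₁ m₂) :
    LinearMap.trace ℝ V (T ∘ₗ T ∘ₗ T) = m₁ * R₁ ^ 3 + m₂ * R₂ ^ 3 := by
  have e : T ∘ₗ T ∘ₗ T = (R₁ + R₂) • (T ∘ₗ T) - (R₁ * R₂) • T := by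
    ext v
    simp [h.quadratic]
  rw [e, map_sub, map_smul, map_smul, h.trace, h.trace_sq]
  simp only [smul_eq_mul]
  ring

end TwoRadii

end ShapeOperator

/-! ### Smoothness and derivatives of matrix expressions -/

section MatrixCalculus

variable {V : Type*} [NormedAddCommGroup V] [NormedSpace ℝ V] {n : ℕ} {Ω : Set V}
  {G : V → Matrix (Fin n) (Fin n) ℝ}

theorem contDiffOn_matrix_det (hG : ∀ i j, ContDiffOn ℝ ∞ (fun u => G u i j) Ω) :
    ContDiffOn ℝ ∞ (fun u => (G u).det) Ω := by
  simp only [Matrix.det_apply']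
  exact ContDiffOn.sum fun σ _ => contDiffOn_const.mul (contDiffOn_prod fun i _ => hG _ _)

theorem contDiffOn_matrix_inv (hG : ∀ i j, ContDiffOn ℝ ∞ (fun u => G u i j) Ω)
    (hdet : ∀ u ∈ Ω, (G u).det ≠ 0) (i j : Fin n) :
    ContDiffOn ℝ ∞ (fun u => (G u)⁻¹ i j) Ω := by
  simp only [Matrix.inv_def, Ring.inverse_eq_inv', Matrix.smul_apply, smul_eq_mul,
    Matrix.adjugate_apply]
  refine ((contDiffOn_matrix_det hG).inv hdet).mul (contDiffOn_matrix_det fun a c => ?_)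
  by_cases h : a = j
  · subst h
    simpa using contDiffOn_const
  · simpa [Matrix.updateRow_ne h] using hG a c

theorem contDiffOn_matrix_mul {H : V → Matrix (Fin n) (Fin n) ℝ}
    (hG : ∀ i j, ContDiffOn ℝ ∞ (fun u => G u i j) Ω)
    (hH : ∀ i j, ContDiffOn ℝ ∞ (fun u => H u i j) Ω) (i j : Fin n) :
    ContDiffOn ℝ ∞ (fun u => (G u * H u) i j) Ω := by
  simp only [Matrix.mul_apply]
  exact ContDiffOn.sum fun k _ => (hG i k).mul (hH k j)

theorem contDiffOn_matrix_trace (hG : ∀ i j, ContDiffOn ℝ ∞ (fun u => G u i j) Ω) :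
    ContDiffOn ℝ ∞ (fun u => (G u).trace) Ω := by
  simp only [Matrix.trace, Matrix.diag]
  exact ContDiffOn.sum fun i _ => hG i i

theorem det_updateRow_eq_sum_adjugate (A : Matrix (Fin n) (Fin n) ℝ) (i : Fin n) (y : Fin n → ℝ) :
    (A.updateRow i y).det = ∑ j, A.adjugate j i * y j := by
  rw [← Matrix.cramer_transpose_apply, Matrix.cramer_eq_adjugate_mulVec, ← Matrix.adjugate_transpose]
  rfl

/-- Jacobi's formula for the derivative of a determinant. -/
theorem dirD_det {u : V} (hG : ∀ i j, DifferentiableAt ℝ (fun w => G w i j) u) (v : V) :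
    dirD v (fun w => (G w).det) u = ∑ i, ∑ j, (G u).adjugate j i * dirD v (fun w => G w i j) u := by
  let D : ContinuousMultilinearMap ℝ (fun _ : Fin n => Fin n → ℝ) ℝ :=
    { (Matrix.detRowAlternating (n := Fin n) (R := ℝ)).toMultilinearMap with
      cont := Continuous.matrix_det (A := fun M : Matrix (Fin n) (Fin n) ℝ => M) continuous_id }
  have hD : ∀ M : Fin n → Fin n → ℝ, D M = Matrix.det (Matrix.of M) := fun M => rfl
  let g : V → Fin n → Fin n → ℝ := fun w i j => G w i j
  have hg : DifferentiableAt ℝ g u :=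
    differentiableAt_pi.2 fun i => differentiableAt_pi.2 fun j => hG i j
  have hcomp := (D.hasFDerivAt (g u)).comp u hg.hasFDerivAt
  have e : (fun w => (G w).det) = D ∘ g := rfl
  have hgv : ∀ i j, fderiv ℝ g u v i j = dirD v (fun w => G w i j) u := by
    intro i j
    have h1 := hasFDerivAt_pi'.1 hg.hasFDerivAt i
    have h2 := hasFDerivAt_pi'.1 h1 j
    unfold dirD
    rw [HasFDerivAt.fderiv h2]
    rfl
  unfold dirD
  rw [e, hcomp.fderiv]
  simp only [ContinuousLinearMap.comp_apply, ContinuousMultilinearMap.linearDeriv_apply]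
  refine Finset.sum_congr rfl fun i _ => ?_
  have : D (Function.update (g u) i (fderiv ℝ g u v i)) =
      ((G u).updateRow i (fderiv ℝ g u v i)).det := rfl
  rw [this, det_updateRow_eq_sum_adjugate]
  exact Finset.sum_congr rfl fun j _ => by rw [hgv]; rfl

end MatrixCalculus

/-! ### Pairings with the coordinate Laplacian -/

section Laplacian

variable {n : ℕ} {E : Type*} [NormedAddCommGroup E] [NormedSpace ℝ E]
  {Ω : Set (Euc n)} {G : Euc n → Matrix (Fin n) (Fin n) ℝ} {Y Z : Euc n → E}

/-- The standard basis vectors. -/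
def stdVec (i : Fin n) : Euc n := EuclideanSpace.single i 1

theorem pd_eq_dirD (i : Fin n) (f : Euc n → E) : pd i f = dirD (stdVec i) f := rfl

/-- The vector fields whose divergence is the Laplacian. -/
def flux (G : Euc n → Matrix (Fin n) (Fin n) ℝ) (Y : Euc n → E) (i : Fin n) (w : Euc n) : E :=
  √((G w).det) • ∑ j, ((G w)⁻¹ i j) • pd j Y w

theorem laplacian_eq_flux (u : Euc n) :
    laplacian G Y u = (√((G u).det))⁻¹ • ∑ i, dirD (stdVec i) (flux G Y i) u := rfl

theorem contDiffOn_sqrt_det (hG : ∀ i j, ContDiffOn ℝ ∞ (fun u => G u i j) Ω)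
    (hdet : ∀ u ∈ Ω, 0 < (G u).det) : ContDiffOn ℝ ∞ (fun u => √((G u).det)) Ω :=
  (contDiffOn_matrix_det hG).sqrt fun u hu => (hdet u hu).ne'

theorem contDiffOn_flux (hΩ : IsOpen Ω) (hG : ∀ i j, ContDiffOn ℝ ∞ (fun u => G u i j) Ω)
    (hdet : ∀ u ∈ Ω, 0 < (G u).det) (hY : ContDiffOn ℝ ∞ Y Ω) (i : Fin n) :
    ContDiffOn ℝ ∞ (flux G Y i) Ω :=
  (contDiffOn_sqrt_det hG hdet).smul <| ContDiffOn.sum fun j _ =>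
    (contDiffOn_matrix_inv hG (fun u hu => (hdet u hu).ne') i j).smul (contDiffOn_dirD hΩ hY _)

theorem contDiffOn_laplacian (hΩ : IsOpen Ω) (hG : ∀ i j, ContDiffOn ℝ ∞ (fun u => G u i j) Ω)
    (hdet : ∀ u ∈ Ω, 0 < (G u).det) (hY : ContDiffOn ℝ ∞ Y Ω) :
    ContDiffOn ℝ ∞ (laplacian G Y) Ω :=
  ((contDiffOn_sqrt_det hG hdet).inv fun u hu => (Real.sqrt_pos.2 (hdet u hu)).ne').smul <|
    ContDiffOn.sum fun i _ => contDiffOn_dirD hΩ (contDiffOn_flux hΩ hG hdet hY i) _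

theorem bilin_flux (b : E →L[ℝ] E →L[ℝ] ℝ) (i : Fin n) (w : Euc n) (X : E) :
    b (flux G Y i w) X = √((G w).det) * ∑ j, (G w)⁻¹ i j * b (dirD (stdVec j) Y w) X := by
  simp [flux, pd_eq_dirD]

theorem bilin_laplacian (b : E →L[ℝ] E →L[ℝ] ℝ) (hΩ : IsOpen Ω)
    (hG : ∀ i j, ContDiffOn ℝ ∞ (fun u => G u i j) Ω)
    (hdet : ∀ u ∈ Ω, 0 < (G u).det) (hY : ContDiffOn ℝ ∞ Y Ω) (hZ : ContDiffOn ℝ ∞ Z Ω) {u : Euc n}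
    (hu : u ∈ Ω) :
    b (laplacian G Y u) (Z u) = (√((G u).det))⁻¹ *
      ∑ i, (dirD (stdVec i) (fun w => b (flux G Y i w) (Z w)) u -
        b (flux G Y i u) (dirD (stdVec i) Z u)) := by
  rw [laplacian_eq_flux, map_smul, smul_apply, smul_eq_mul, map_sum, sum_apply]
  congr 1
  refine Finset.sum_congr rfl fun i _ => ?_
  rw [dirD_bilin b (differentiableAt_of_contDiffOn hΩ (contDiffOn_flux hΩ hG hdet hY i) hu)
    (differentiableAt_of_contDiffOn hΩ hZ hu)]
  ring

/-- Orthogonality makes `⟨flux, Z⟩` vanish identically, so the product rule leaves only minus the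
metric trace of `⟨dY, dZ⟩`. -/
theorem bilin_laplacian_of_orthogonal (b : E →L[ℝ] E →L[ℝ] ℝ) (hΩ : IsOpen Ω)
    (hG : ∀ i j, ContDiffOn ℝ ∞ (fun u => G u i j) Ω)
    (hdet : ∀ u ∈ Ω, 0 < (G u).det) (hY : ContDiffOn ℝ ∞ Y Ω) (hZ : ContDiffOn ℝ ∞ Z Ω)
    (horth : ∀ u ∈ Ω, ∀ v, b (dirD v Y u) (Z u) = 0) {u : Euc n} (hu : u ∈ Ω) :
    b (laplacian G Y u) (Z u) =
      -∑ i, ∑ j, (G u)⁻¹ i j * b (dirD (stdVec j) Y u) (dirD (stdVec i) Z u) := by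
  have hs := (Real.sqrt_pos.2 (hdet u hu)).ne'
  rw [bilin_laplacian b hΩ hG hdet hY hZ hu]
  have h0 : ∀ i, dirD (stdVec i) (fun w => b (flux G Y i w) (Z w)) u = 0 := fun i =>
    dirD_eq_zero_of_const hΩ (c := 0) (fun w hw => by rw [bilin_flux]; simp [horth w hw]) hu _
  simp only [h0, zero_sub, Finset.sum_neg_distrib]
  simp only [bilin_flux]
  rw [← Finset.mul_sum, mul_neg, ← mul_assoc, inv_mul_cancel₀ hs, one_mul]

/-- For an induced metric `ΔY` is normal to the image. The divergence of `⟨flux, ∂ₖY⟩` is `∂ₖ√(det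
G)`, and Jacobi's formula identifies this with the remaining term of the product rule. -/
theorem bilin_laplacian_dirD (b : E →L[ℝ] E →L[ℝ] ℝ) (hb : ∀ X Z, b X Z = b Z X) (hΩ : IsOpen Ω)
    (hG : ∀ i j, ContDiffOn ℝ ∞ (fun u => G u i j) Ω)
    (hdet : ∀ u ∈ Ω, 0 < (G u).det) (hY : ContDiffOn ℝ ∞ Y Ω)
    (hGY : ∀ u ∈ Ω, ∀ i j, G u i j = b (dirD (stdVec i) Y u) (dirD (stdVec j) Y u))
    {u : Euc n} (hu : u ∈ Ω) (k : Fin n) :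
    b (laplacian G Y u) (dirD (stdVec k) Y u) = 0 := by
  have hs := (Real.sqrt_pos.2 (hdet u hu)).ne'
  have sY := contDiffOn_dirD hΩ hY
  have dY := fun v => differentiableAt_of_contDiffOn hΩ (sY v) hu
  have hsymm : ∀ i j, (G u)⁻¹ i j = (G u)⁻¹ j i := by
    have : (G u).transpose = G u := by
      ext i j; rw [Matrix.transpose_apply, hGY u hu, hGY u hu, hb]
    intro i j
    conv_lhs => rw [← this, ← Matrix.transpose_nonsing_inv, Matrix.transpose_apply]
  rw [bilin_laplacian b hΩ hG hdet hY (sY _) hu, Finset.sum_sub_distrib]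
  have h1 : ∀ i, dirD (stdVec i) (fun w => b (flux G Y i w) (dirD (stdVec k) Y w)) u =
      if i = k then dirD (stdVec k) (fun w => √((G w).det)) u else 0 := by
    intro i
    have e : ∀ w ∈ Ω, b (flux G Y i w) (dirD (stdVec k) Y w) =
        √((G w).det) * (1 : Matrix (Fin n) (Fin n) ℝ) i k := by
      intro w hw
      rw [bilin_flux]
      simp only [← hGY w hw]
      rw [← Matrix.mul_apply, Matrix.nonsing_inv_mul _ (hdet w hw).ne'.isUnit]
    rw [dirD_congr hΩ e hu]
    by_cases hik : i = k
    · subst hik; simp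
    · simp [hik, dirD]
  simp only [h1, Finset.sum_ite_eq', Finset.mem_univ, if_true]
  have h2 : dirD (stdVec k) (fun w => √((G w).det)) u =
      (2 * √((G u).det))⁻¹ * dirD (stdVec k) (fun w => (G w).det) u := by
    have := ((differentiableAt_of_contDiffOn hΩ (contDiffOn_matrix_det hG) hu).hasFDerivAt.sqrt
      (hdet u hu).ne').fderiv
    unfold dirD
    rw [this]
    simp
  have h3 : ∀ i j, dirD (stdVec k) (fun w => G w i j) u =
      b (dirD (stdVec k) (dirD (stdVec i) Y) u) (dirD (stdVec j) Y u) +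
      b (dirD (stdVec k) (dirD (stdVec j) Y) u) (dirD (stdVec i) Y u) := by
    intro i j
    rw [dirD_congr hΩ (fun w hw => hGY w hw i j) hu, dirD_bilin b (dY _) (dY _),
      hb (dirD (stdVec i) Y u)]
  have hadj : ∀ i j, (G u).adjugate i j = (G u).det * (G u)⁻¹ i j := by
    intro i j
    rw [Matrix.inv_def, Ring.inverse_eq_inv', Matrix.smul_apply, smul_eq_mul,
      mul_inv_cancel_left₀ (hdet u hu).ne']
  have h4 : dirD (stdVec k) (fun w => (G w).det) u = 2 * (G u).det *
      ∑ i, ∑ j, (G u)⁻¹ i j * b (dirD (stdVec j) Y u) (dirD (stdVec i) (dirD (stdVec k) Y) u) := by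
    rw [dirD_det fun i j => differentiableAt_of_contDiffOn hΩ (hG i j) hu]
    simp only [h3, hadj, mul_add, Finset.sum_add_distrib]
    have s1 : ∑ i, ∑ j, (G u).det * (G u)⁻¹ j i *
        b (dirD (stdVec k) (dirD (stdVec j) Y) u) (dirD (stdVec i) Y u) =
        ∑ i, ∑ j, (G u).det * (G u)⁻¹ j i *
        b (dirD (stdVec k) (dirD (stdVec i) Y) u) (dirD (stdVec j) Y u) := by
      rw [Finset.sum_comm]
      exact Finset.sum_congr rfl fun i _ => Finset.sum_congr rfl fun j _ => by rw [hsymm i j]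
    rw [s1, ← two_mul, mul_assoc, Finset.mul_sum (a := (G u).det)]
    congr 1
    refine Finset.sum_congr rfl fun i _ => ?_
    rw [Finset.mul_sum]
    refine Finset.sum_congr rfl fun j _ => ?_
    rw [hsymm j i, mul_assoc, hb, dirD_comm hΩ hY hu (stdVec k)]
  rw [h2, h4]
  simp only [bilin_flux]
  rw [← Finset.mul_sum]
  have hsq : (G u).det = √((G u).det) * √((G u).det) := (Real.mul_self_sqrt (hdet u hu).le).symm
  field_simp
  rw [Real.sq_sqrt (hdet u hu).le]
  ring

end Laplacian

/-! ### The ambient inner product -/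

section Form

variable {n : ℕ}

theorem form_comm (X Z : Amb n) : form X Z = form Z X := by
  simp only [form, real_inner_comm, mul_comm]

/-- The inner product of `ℝ^{n+4}_2` as a continuous bilinear map. -/
def formL (n : ℕ) : Amb n →L[ℝ] Amb n →L[ℝ] ℝ :=
  LinearMap.toContinuousBilinearMap <| LinearMap.mk₂ ℝ form
    (fun X X' Z => by simp [form, inner_add_left]; ring)
    (fun c X Z => by simp [form, inner_smul_left]; ring)
    (fun X Z Z' => by simp [form, inner_add_right]; ring)
    (fun c X Z => by simp [form, inner_smul_right]; ring)

theorem formL_apply (X Z : Amb n) : formL n X Z = form X Z := rfl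

/-- The isotropic vector `P = (1, -1, 0, 0)`. -/
def pVec (n : ℕ) : Amb n := (1, -1, 0, 0)

end Form

/-! ### Hypersurfaces with two radii: smoothness and the conformal radius operator -/

section Frame

variable {n : ℕ}

/-- The point sphere of `x`. -/
def pointSphere {M : Type*} (x : M → Euc (n + 1)) (p : M) : Amb n :=
  ((1 + ‖x p‖ ^ 2) / 2, (1 - ‖x p‖ ^ 2) / 2, x p, 0)

/-- A parametrized hypersurface with unit normal `Ξ`, radius operators `T`, exactly two radii of
curvature `R₁`, `R₂` of multiplicities `m₁`, `m₂`, mean radius `r` and deviation `ρ`. -/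
structure TwoRadiiHypersurface (Ω : Set (Euc n)) (X Ξ : Euc n → Euc (n + 1)) (ρ r : Euc n → ℝ)
    (T : Euc n → Euc n →ₗ[ℝ] Euc n) (R₁ R₂ : Euc n → ℝ) (m₁ m₂ : Euc n → ℕ) : Prop where
  isOpen : IsOpen Ω
  smooth_X : ContDiffOn ℝ ∞ X Ω
  smooth_Ξ : ContDiffOn ℝ ∞ Ξ Ω
  unit : ∀ u ∈ Ω, ‖Ξ u‖ = 1
  normal : ∀ u ∈ Ω, ∀ v, inner ℝ (Ξ u) (dirD v X u) = 0
  inj : ∀ u ∈ Ω, Function.Injective (fderiv ℝ Ξ u)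
  dX : ∀ u ∈ Ω, ∀ v, dirD v X u = -dirD (T u v) Ξ u
  radii : ∀ u ∈ Ω, TwoRadii (T u) (R₁ u) (R₂ u) (m₁ u) (m₂ u)
  mean : ∀ u ∈ Ω, r u = (m₁ u * R₁ u + m₂ u * R₂ u) / n
  dev : ∀ u ∈ Ω, ρ u = √(m₁ u * (r u - R₁ u) ^ 2 + m₂ u * (r u - R₂ u) ^ 2)

theorem inner_dirD_of_unit {V E : Type*} [NormedAddCommGroup V] [NormedSpace ℝ V]
    [NormedAddCommGroup E] [InnerProductSpace ℝ E] {Ω : Set V} (hΩ : IsOpen Ω) {f : V → E}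
    (hf : ContDiffOn ℝ ∞ f Ω) (hunit : ∀ u ∈ Ω, ‖f u‖ = 1) {u : V} (hu : u ∈ Ω) (v : V) :
    inner ℝ (f u) (dirD v f u) = 0 := by
  have d := differentiableAt_of_contDiffOn hΩ hf hu
  have h0 := dirD_eq_zero_of_const hΩ (f := fun w => inner ℝ (f w) (f w)) (c := 1)
    (fun w hw => by rw [real_inner_self_eq_norm_sq, hunit w hw, one_pow]) hu v
  unfold dirD at h0 ⊢
  rw [fderiv_inner_apply ℝ d d, real_inner_comm] at h0
  rw [real_inner_comm]
  linarith

/-- The matrix of an endomorphism of `ℝ^n` in the standard basis. -/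
def stdMatrix (T : Euc n →ₗ[ℝ] Euc n) : Matrix (Fin n) (Fin n) ℝ :=
  LinearMap.toMatrix (EuclideanSpace.basisFun (Fin n) ℝ).toBasis
    (EuclideanSpace.basisFun (Fin n) ℝ).toBasis T

theorem apply_stdVec (T : Euc n →ₗ[ℝ] Euc n) (i : Fin n) :
    T (stdVec i) = ∑ k, stdMatrix T k i • stdVec k := by
  have := ((EuclideanSpace.basisFun (Fin n) ℝ).toBasis.sum_repr (T (stdVec i))).symm
  simpa [stdMatrix, LinearMap.toMatrix_apply, stdVec] using this

theorem trace_eq_stdMatrix (T : Euc n →ₗ[ℝ] Euc n) :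
    LinearMap.trace ℝ _ T = (stdMatrix T).trace :=
  LinearMap.trace_eq_matrix_trace ℝ _ T

theorem stdMatrix_comp (S T : Euc n →ₗ[ℝ] Euc n) :
    stdMatrix (S ∘ₗ T) = stdMatrix S * stdMatrix T :=
  LinearMap.toMatrix_comp _ _ _ S T

theorem dirD_apply_stdVec {E : Type*} [NormedAddCommGroup E] [NormedSpace ℝ E] (f : Euc n → E)
    (T : Euc n →ₗ[ℝ] Euc n) (i : Fin n) (u : Euc n) :
    dirD (T (stdVec i)) f u = ∑ k, stdMatrix T k i • dirD (stdVec k) f u := by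
  rw [apply_stdVec]
  simp [dirD]

theorem linearIndependent_dirD {E : Type*} [NormedAddCommGroup E] [NormedSpace ℝ E]
    {f : Euc n → E} {u : Euc n} (hf : Function.Injective (fderiv ℝ f u)) :
    LinearIndependent ℝ fun i => dirD (stdVec i) f u := by
  have := (EuclideanSpace.basisFun (Fin n) ℝ).toBasis.linearIndependent.map'
    (fderiv ℝ f u).toLinearMap (LinearMap.ker_eq_bot.2 hf)
  have e : (fun i => dirD (stdVec i) f u) =
      (fderiv ℝ f u).toLinearMap ∘ (EuclideanSpace.basisFun (Fin n) ℝ).toBasis := by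
    funext i
    simp [dirD, stdVec]
  rw [e]
  exact this

namespace TwoRadiiHypersurface

variable {Ω : Set (Euc n)} {X Ξ : Euc n → Euc (n + 1)} {ρ r : Euc n → ℝ}
    {T : Euc n → Euc n →ₗ[ℝ] Euc n} {R₁ R₂ : Euc n → ℝ} {m₁ m₂ : Euc n → ℕ}

theorem cast_add (h : TwoRadiiHypersurface Ω X Ξ ρ r T R₁ R₂ m₁ m₂) {u : Euc n} (hu : u ∈ Ω) :
    (n : ℝ) = m₁ u + m₂ u := by
  have := (h.radii u hu).add
  rw [finrank_euclideanSpace_fin] at this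
  exact_mod_cast this.symm

theorem cast_pos (h : TwoRadiiHypersurface Ω X Ξ ρ r T R₁ R₂ m₁ m₂) {u : Euc n} (hu : u ∈ Ω) :
    (0 : ℝ) < m₁ u ∧ (0 : ℝ) < m₂ u ∧ (0 : ℝ) < n := by
  have h1 : (0 : ℝ) < m₁ u := by exact_mod_cast (h.radii u hu).pos₁
  have h2 : (0 : ℝ) < m₂ u := by exact_mod_cast (h.radii u hu).pos₂
  exact ⟨h1, h2, by rw [h.cast_add hu]; linarith⟩

theorem mean_eq_trace (h : TwoRadiiHypersurface Ω X Ξ ρ r T R₁ R₂ m₁ m₂) {u : Euc n}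
    (hu : u ∈ Ω) : r u = (stdMatrix (T u)).trace / n := by
  rw [h.mean u hu, ← trace_eq_stdMatrix, (h.radii u hu).trace]

theorem dev_sq (h : TwoRadiiHypersurface Ω X Ξ ρ r T R₁ R₂ m₁ m₂) {u : Euc n} (hu : u ∈ Ω) :
    ρ u ^ 2 = m₁ u * m₂ u / n * (R₁ u - R₂ u) ^ 2 := by
  rw [h.dev u hu, Real.sq_sqrt (by positivity), h.cast_add hu]
  exact (h.radii u hu).sum_sq (by rw [h.mean u hu, h.cast_add hu])

theorem dev_pos (h : TwoRadiiHypersurface Ω X Ξ ρ r T R₁ R₂ m₁ m₂) {u : Euc n} (hu : u ∈ Ω) :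
    0 < ρ u := by
  obtain ⟨h1, h2, h3⟩ := h.cast_pos hu
  have h4 : 0 < (R₁ u - R₂ u) ^ 2 := by
    have := sub_ne_zero.2 (h.radii u hu).ne
    positivity
  have h5 : 0 < ρ u ^ 2 := by rw [h.dev_sq hu]; positivity
  have h6 : 0 ≤ ρ u := by rw [h.dev u hu]; positivity
  exact lt_of_le_of_ne h6 fun h0 => by rw [← h0] at h5; simp at h5

theorem dev_eq_sqrt_trace (h : TwoRadiiHypersurface Ω X Ξ ρ r T R₁ R₂ m₁ m₂) {u : Euc n}
    (hu : u ∈ Ω) :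
    ρ u = √((stdMatrix (T u) * stdMatrix (T u)).trace - (stdMatrix (T u)).trace ^ 2 / n) := by
  have hn := (h.cast_pos hu).2.2.ne'
  rw [← Real.sqrt_sq (h.dev_pos hu).le, h.dev_sq hu, ← stdMatrix_comp, ← trace_eq_stdMatrix,
    ← trace_eq_stdMatrix, (h.radii u hu).trace, (h.radii u hu).trace_sq]
  congr 1
  field_simp
  rw [h.cast_add hu]
  ring

theorem smooth_gram (h : TwoRadiiHypersurface Ω X Ξ ρ r T R₁ R₂ m₁ m₂) (i j : Fin n) :
    ContDiffOn ℝ ∞ (fun u => Matrix.gram ℝ (fun k => dirD (stdVec k) Ξ u) i j) Ω :=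
  (contDiffOn_dirD h.isOpen h.smooth_Ξ _).inner ℝ (contDiffOn_dirD h.isOpen h.smooth_Ξ _)

theorem posDef_gram (h : TwoRadiiHypersurface Ω X Ξ ρ r T R₁ R₂ m₁ m₂) {u : Euc n}
    (hu : u ∈ Ω) : (Matrix.gram ℝ (fun k => dirD (stdVec k) Ξ u)).PosDef :=
  Matrix.posDef_gram_of_linearIndependent (linearIndependent_dirD (h.inj u hu))

/-- `T` is only given pointwise, but pairing `dX = -dΞ ∘ T` with `dΞ` solves for its matrix as the
inverse Gram matrix of `dΞ` times a smooth matrix. -/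
theorem smooth_stdMatrix (h : TwoRadiiHypersurface Ω X Ξ ρ r T R₁ R₂ m₁ m₂) (i j : Fin n) :
    ContDiffOn ℝ ∞ (fun u => stdMatrix (T u) i j) Ω := by
  let M : Euc n → Matrix (Fin n) (Fin n) ℝ := fun u =>
    Matrix.of fun a c => -inner ℝ (dirD (stdVec a) Ξ u) (dirD (stdVec c) X u)
  have hM : ∀ a c, ContDiffOn ℝ ∞ (fun u => M u a c) Ω := fun a c =>
    ((contDiffOn_dirD h.isOpen h.smooth_Ξ _).inner ℝ (contDiffOn_dirD h.isOpen h.smooth_X _)).neg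
  have key := contDiffOn_matrix_mul
    (contDiffOn_matrix_inv h.smooth_gram fun u hu => (h.posDef_gram hu).det_pos.ne') hM i j
  refine key.congr fun u hu => ?_
  have e : M u = Matrix.gram ℝ (fun k => dirD (stdVec k) Ξ u) * stdMatrix (T u) := by
    ext a c
    simp only [M, Matrix.of_apply, h.dX u hu, inner_neg_right, neg_neg, dirD_apply_stdVec,
      inner_sum, inner_smul_right, Matrix.mul_apply, Matrix.gram_apply]
    exact Finset.sum_congr rfl fun k _ => mul_comm _ _
  rw [e, ← Matrix.mul_assoc, Matrix.nonsing_inv_mul _ (h.posDef_gram hu).det_pos.ne'.isUnit,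
    Matrix.one_mul]

theorem smooth_mean (h : TwoRadiiHypersurface Ω X Ξ ρ r T R₁ R₂ m₁ m₂) : ContDiffOn ℝ ∞ r Ω :=
  ((contDiffOn_matrix_trace h.smooth_stdMatrix).div_const _).congr fun _ hu => h.mean_eq_trace hu

theorem smooth_dev (h : TwoRadiiHypersurface Ω X Ξ ρ r T R₁ R₂ m₁ m₂) : ContDiffOn ℝ ∞ ρ Ω := by
  have key := (contDiffOn_matrix_trace
    (contDiffOn_matrix_mul h.smooth_stdMatrix h.smooth_stdMatrix)).sub
    (((contDiffOn_matrix_trace h.smooth_stdMatrix).pow 2).div_const (n : ℝ))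
  refine (key.sqrt fun u hu h0 => ?_).congr fun u hu => h.dev_eq_sqrt_trace hu
  have := h.dev_pos hu
  rw [h.dev_eq_sqrt_trace hu, h0] at this
  simp at this

/-- The sum of the two eigenvalues of the conformal radius operator `(T - r) / ρ`. -/
def conformalSum (ρ r R₁ R₂ : Euc n → ℝ) (u : Euc n) : ℝ := (R₁ u + R₂ u - 2 * r u) / ρ u

/-- With `S = (T - r) / ρ` the right side is `tr S³`, which equals `s tr S² + (1/n) tr S = s`.
Unlike `R₁` and `R₂`, it is visibly continuous. -/
theorem conformalSum_eq_trace (h : TwoRadiiHypersurface Ω X Ξ ρ r T R₁ R₂ m₁ m₂) {u : Euc n}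
    (hu : u ∈ Ω) : conformalSum ρ r R₁ R₂ u =
      ((stdMatrix (T u) * (stdMatrix (T u) * stdMatrix (T u))).trace
        - 3 * r u * (stdMatrix (T u) * stdMatrix (T u)).trace
        + 3 * r u ^ 2 * (stdMatrix (T u)).trace - n * r u ^ 3) / ρ u ^ 3 := by
  have hn := (h.cast_pos hu).2.2.ne'
  have hρ := (h.dev_pos hu).ne'
  have hρ2 := h.dev_sq hu
  rw [← stdMatrix_comp, ← stdMatrix_comp, ← trace_eq_stdMatrix, ← trace_eq_stdMatrix,
    ← trace_eq_stdMatrix, (h.radii u hu).trace, (h.radii u hu).trace_sq, (h.radii u hu).trace_cube,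
    conformalSum, div_eq_div_iff hρ (by positivity), pow_succ _ 2, ← mul_assoc, hρ2, h.mean u hu,
    h.cast_add hu]
  rw [h.cast_add hu] at hn
  field_simp
  ring

theorem conformalSum_sq (h : TwoRadiiHypersurface Ω X Ξ ρ r T R₁ R₂ m₁ m₂) {u : Euc n}
    (hu : u ∈ Ω) : conformalSum ρ r R₁ R₂ u ^ 2 =
      ((m₁ u : ℝ) - m₂ u) ^ 2 / (n * (m₁ u * m₂ u)) := by
  obtain ⟨h1, h2, hn⟩ := h.cast_pos hu
  have hρ := (h.dev_pos hu).ne'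
  have hR := sub_ne_zero.2 (h.radii u hu).ne
  rw [conformalSum, div_pow, h.dev_sq hu, h.mean u hu, div_eq_div_iff (by positivity)
    (by positivity)]
  rw [h.cast_add hu] at hn ⊢
  field_simp
  ring

/-- A continuous function on a preconnected set is constant once its values lie in a countable set;
by `conformalSum_sq` only the multiplicities determine them, up to sign. -/
theorem conformalSum_const (h : TwoRadiiHypersurface Ω X Ξ ρ r T R₁ R₂ m₁ m₂)
    (hconn : IsPreconnected Ω) : ∃ s, ∀ u ∈ Ω, conformalSum ρ r R₁ R₂ u = s := by
  obtain rfl | ⟨u₀, hu₀⟩ := Ω.eq_empty_or_nonempty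
  · exact ⟨0, by simp⟩
  refine ⟨conformalSum ρ r R₁ R₂ u₀, fun u hu => ?_⟩
  have hTT := contDiffOn_matrix_mul h.smooth_stdMatrix h.smooth_stdMatrix
  have hcont : ContinuousOn (conformalSum ρ r R₁ R₂) Ω := by
    refine ContinuousOn.congr ?_ fun u hu => h.conformalSum_eq_trace hu
    have c1 := (contDiffOn_matrix_trace h.smooth_stdMatrix).continuousOn
    have c2 := (contDiffOn_matrix_trace hTT).continuousOn
    have c3 := (contDiffOn_matrix_trace (contDiffOn_matrix_mul h.smooth_stdMatrix hTT)).continuousOn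
    have cr := h.smooth_mean.continuousOn
    refine ContinuousOn.div ?_ (h.smooth_dev.continuousOn.pow 3) fun u hu =>
      pow_ne_zero 3 (h.dev_pos hu).ne'
    exact ((c3.sub ((continuousOn_const.mul cr).mul c2)).add
      ((continuousOn_const.mul (cr.pow 2)).mul c1)).sub (continuousOn_const.mul (cr.pow 3))
  let q : ℕ × ℕ → ℝ := fun m => √(((m.1 : ℝ) - m.2) ^ 2 / (n * (m.1 * m.2)))
  have hcount : (Set.range q ∪ Set.range fun m => -q m).Countable :=
    (Set.countable_range _).union (Set.countable_range _)
  refine hcount.isTotallyDisconnected _ ?_ (hconn.image _ hcont) ⟨u, hu, rfl⟩ ⟨u₀, hu₀, rfl⟩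
  rintro _ ⟨w, hw, rfl⟩
  have hq : |conformalSum ρ r R₁ R₂ w| = q (m₁ w, m₂ w) := by
    simp only [q]
    rw [← h.conformalSum_sq hw, Real.sqrt_sq_eq_abs]
  rcases abs_choice (conformalSum ρ r R₁ R₂ w) with h' | h'
  · exact Or.inl ⟨_, by rw [← hq, h']⟩
  · exact Or.inr ⟨(m₁ w, m₂ w), by simp only; rw [← hq, h', neg_neg]⟩

/-- The conformal radius operator. -/
def conformalOperator (ρ r : Euc n → ℝ) (T : Euc n → Euc n →ₗ[ℝ] Euc n) (u : Euc n) :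
    Euc n →ₗ[ℝ] Euc n := (ρ u)⁻¹ • (T u - r u • LinearMap.id)

/-- The eigenvalues `(Rᵢ - r) / ρ` have product `-1/n`, whatever the multiplicities. -/
theorem conformalOperator_quadratic (h : TwoRadiiHypersurface Ω X Ξ ρ r T R₁ R₂ m₁ m₂)
    {u : Euc n} (hu : u ∈ Ω) (v : Euc n) :
    conformalOperator ρ r T u (conformalOperator ρ r T u v) =
      conformalSum ρ r R₁ R₂ u • conformalOperator ρ r T u v + (1 / n : ℝ) • v := by
  obtain ⟨h1, h2, hn⟩ := h.cast_pos hu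
  have hρ := (h.dev_pos hu).ne'
  have key : (1 / n : ℝ) = (ρ u)⁻¹ * (ρ u)⁻¹ * (r u * (R₁ u + R₂ u) - r u ^ 2 - R₁ u * R₂ u) := by
    have e : r u * (R₁ u + R₂ u) - r u ^ 2 - R₁ u * R₂ u = ρ u ^ 2 / n := by
      rw [h.dev_sq hu, h.mean u hu]
      rw [h.cast_add hu] at hn ⊢
      field_simp
      ring
    rw [e]
    field_simp
  rw [key]
  simp only [conformalOperator, conformalSum, LinearMap.smul_apply, LinearMap.sub_apply,
    LinearMap.id_apply, map_smul, map_sub, (h.radii u hu).quadratic]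
  match_scalars <;> field_simp <;> ring

theorem trace_conformalOperator (h : TwoRadiiHypersurface Ω X Ξ ρ r T R₁ R₂ m₁ m₂)
    {u : Euc n} (hu : u ∈ Ω) : (stdMatrix (conformalOperator ρ r T u)).trace = 0 := by
  have hn := (h.cast_pos hu).2.2.ne'
  rw [← trace_eq_stdMatrix, conformalOperator, map_smul, map_sub, map_smul, trace_eq_stdMatrix,
    LinearMap.trace_id, h.mean_eq_trace hu, finrank_euclideanSpace_fin]
  simp only [smul_eq_mul]
  field_simp
  simp

end TwoRadiiHypersurface

end Frame

/-! ### Derivatives of product-valued maps -/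

section ProductDerivative

variable {V E F : Type*} [NormedAddCommGroup V] [NormedSpace ℝ V] [NormedAddCommGroup E]
  [NormedSpace ℝ E] [NormedAddCommGroup F] [NormedSpace ℝ F]

theorem dirD_prodMk {f : V → E} {g : V → F} {u : V} (hf : DifferentiableAt ℝ f u)
    (hg : DifferentiableAt ℝ g u) (v : V) :
    dirD v (fun w => (f w, g w)) u = (dirD v f u, dirD v g u) := by
  unfold dirD
  rw [hf.fderiv_prodMk hg]
  rfl

end ProductDerivative

/-! ### The Laguerre frame and its structure equations -/

variable {n : ℕ}

/-- The conformal position map `ρ y`. -/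
def confPos (ρ : Euc n → ℝ) (X Ξ : Euc n → Euc (n + 1)) (u : Euc n) : Amb n := ρ u • yMap X Ξ u

/-- The conformal normal map. -/
def confNor (r : Euc n → ℝ) (X Ξ : Euc n → Euc (n + 1)) (u : Euc n) : Amb n :=
  pointSphere X u + r u • yMap X Ξ u

/-- The coefficients of the conformal metric `ρ² ⟨dy, dy⟩`. -/
def confMetric (ρ : Euc n → ℝ) (X Ξ : Euc n → Euc (n + 1)) (u : Euc n) :
    Matrix (Fin n) (Fin n) ℝ :=
  Matrix.of fun i j =>
    ρ u ^ 2 * formL n (dirD (stdVec i) (yMap X Ξ) u) (dirD (stdVec j) (yMap X Ξ) u)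

/-- The map `N` completing the Laguerre frame. -/
def confN (ρ : Euc n → ℝ) (X Ξ : Euc n → Euc (n + 1)) (u : Euc n) : Amb n :=
  (1 / (n : ℝ)) • laplacian (confMetric ρ X Ξ) (confPos ρ X Ξ) u +
    (1 / (2 * (n : ℝ) ^ 2) * formL n (laplacian (confMetric ρ X Ξ) (confPos ρ X Ξ) u)
      (laplacian (confMetric ρ X Ξ) (confPos ρ X Ξ) u)) • confPos ρ X Ξ u

namespace TwoRadiiHypersurface

variable {Ω : Set (Euc n)} {X Ξ : Euc n → Euc (n + 1)} {ρ r : Euc n → ℝ}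
    {T : Euc n → Euc n →ₗ[ℝ] Euc n} {R₁ R₂ : Euc n → ℝ} {m₁ m₂ : Euc n → ℕ}

theorem normal_dΞ (h : TwoRadiiHypersurface Ω X Ξ ρ r T R₁ R₂ m₁ m₂) {u : Euc n} (hu : u ∈ Ω)
    (v : Euc n) : inner ℝ (Ξ u) (dirD v Ξ u) = 0 :=
  inner_dirD_of_unit h.isOpen h.smooth_Ξ h.unit hu v

theorem smooth_y (h : TwoRadiiHypersurface Ω X Ξ ρ r T R₁ R₂ m₁ m₂) :
    ContDiffOn ℝ ∞ (yMap X Ξ) Ω :=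
  (h.smooth_X.inner ℝ h.smooth_Ξ).prodMk <| (h.smooth_X.inner ℝ h.smooth_Ξ).neg.prodMk <|
    h.smooth_Ξ.prodMk contDiffOn_const

theorem smooth_pointSphere (h : TwoRadiiHypersurface Ω X Ξ ρ r T R₁ R₂ m₁ m₂) :
    ContDiffOn ℝ ∞ (pointSphere X) Ω :=
  ((contDiffOn_const.add (h.smooth_X.norm_sq ℝ)).div_const 2).prodMk <|
    ((contDiffOn_const.sub (h.smooth_X.norm_sq ℝ)).div_const 2).prodMk <|
    h.smooth_X.prodMk contDiffOn_const

theorem dirD_y (h : TwoRadiiHypersurface Ω X Ξ ρ r T R₁ R₂ m₁ m₂) {u : Euc n} (hu : u ∈ Ω)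
    (v : Euc n) : dirD v (yMap X Ξ) u =
      (inner ℝ (X u) (dirD v Ξ u), -inner ℝ (X u) (dirD v Ξ u), dirD v Ξ u, 0) := by
  have dX := differentiableAt_of_contDiffOn h.isOpen h.smooth_X hu
  have dΞ := differentiableAt_of_contDiffOn h.isOpen h.smooth_Ξ hu
  have di : DifferentiableAt ℝ (fun w => inner ℝ (X w) (Ξ w)) u := dX.inner ℝ dΞ
  have e : dirD v (fun w => inner ℝ (X w) (Ξ w)) u = inner ℝ (X u) (dirD v Ξ u) := by
    have hn := h.normal u hu v
    unfold dirD at hn ⊢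
    rw [fderiv_inner_apply ℝ dX dΞ, real_inner_comm (Ξ u), hn, add_zero]
  have di' : DifferentiableAt ℝ (fun w => -inner ℝ (X w) (Ξ w)) u := di.neg
  have e' : dirD v (fun w => -inner ℝ (X w) (Ξ w)) u = -inner ℝ (X u) (dirD v Ξ u) := by
    rw [← e]
    simp [dirD]
  have e0 : dirD v (fun _ => (1 : ℝ)) u = 0 := by simp [dirD]
  unfold yMap
  rw [dirD_prodMk di (di'.prodMk (dΞ.prodMk (differentiableAt_const _))),
    dirD_prodMk di' (dΞ.prodMk (differentiableAt_const _)),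
    dirD_prodMk dΞ (differentiableAt_const _), e, e', e0]

/-- Both differentials have the form `(x·w, -x·w, w, 0)`, linear in `w`, with `w = dx(v)` on the
left and `w = dξ(T v)` for `dy(T v)`; so `dx = -dξ ∘ T` lifts. -/
theorem dirD_pointSphere (h : TwoRadiiHypersurface Ω X Ξ ρ r T R₁ R₂ m₁ m₂) {u : Euc n}
    (hu : u ∈ Ω) (v : Euc n) :
    dirD v (pointSphere X) u = -dirD (T u v) (yMap X Ξ) u := by
  have dX := differentiableAt_of_contDiffOn h.isOpen h.smooth_X hu
  have dn : DifferentiableAt ℝ (fun w => ‖X w‖ ^ 2) u := dX.norm_sq ℝ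
  have e : dirD v (fun w => ‖X w‖ ^ 2) u = 2 * inner ℝ (X u) (dirD v X u) := by
    unfold dirD
    simp only [← real_inner_self_eq_norm_sq]
    rw [fderiv_inner_apply ℝ dX dX, real_inner_comm (X u)]
    ring
  have e1 : dirD v (fun w => (1 + ‖X w‖ ^ 2) / 2) u = inner ℝ (X u) (dirD v X u) := by
    have := (((dn.hasFDerivAt).const_add 1).mul_const (2 : ℝ)⁻¹).fderiv
    simp only [div_eq_mul_inv]
    unfold dirD at e ⊢
    rw [this, smul_apply, e]
    simp
  have e2 : dirD v (fun w => (1 - ‖X w‖ ^ 2) / 2) u = -inner ℝ (X u) (dirD v X u) := by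
    have := (((dn.hasFDerivAt).const_sub 1).mul_const (2 : ℝ)⁻¹).fderiv
    simp only [div_eq_mul_inv]
    unfold dirD at e ⊢
    rw [this, smul_apply, neg_apply, e]
    simp
  have e0 : dirD v (fun _ => (0 : ℝ)) u = 0 := by simp [dirD]
  have d1 : DifferentiableAt ℝ (fun w => (1 + ‖X w‖ ^ 2) / 2) u := by
    simp only [div_eq_mul_inv]; exact (dn.const_add 1).mul_const _
  have d2 : DifferentiableAt ℝ (fun w => (1 - ‖X w‖ ^ 2) / 2) u := by
    simp only [div_eq_mul_inv]; exact (dn.const_sub 1).mul_const _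
  unfold pointSphere
  rw [dirD_prodMk d1 (d2.prodMk (dX.prodMk (differentiableAt_const _))),
    dirD_prodMk d2 (dX.prodMk (differentiableAt_const _)),
    dirD_prodMk dX (differentiableAt_const _), e1, e2, e0, h.dirD_y hu, h.dX u hu]
  simp

theorem form_y_y (h : TwoRadiiHypersurface Ω X Ξ ρ r T R₁ R₂ m₁ m₂) {u : Euc n} (hu : u ∈ Ω) :
    formL n (yMap X Ξ u) (yMap X Ξ u) = 0 := by
  simp [formL_apply, form, yMap, h.unit u hu]

theorem form_dy_y (h : TwoRadiiHypersurface Ω X Ξ ρ r T R₁ R₂ m₁ m₂) {u : Euc n} (hu : u ∈ Ω)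
    (v : Euc n) : formL n (dirD v (yMap X Ξ) u) (yMap X Ξ u) = 0 := by
  rw [h.dirD_y hu]
  simp [formL_apply, form, yMap, real_inner_comm (Ξ u), h.normal_dΞ hu]

theorem form_dy_dy (h : TwoRadiiHypersurface Ω X Ξ ρ r T R₁ R₂ m₁ m₂) {u : Euc n} (hu : u ∈ Ω)
    (v w : Euc n) : formL n (dirD v (yMap X Ξ) u) (dirD w (yMap X Ξ) u) =
      inner ℝ (dirD v Ξ u) (dirD w Ξ u) := by
  rw [h.dirD_y hu, h.dirD_y hu]
  simp [formL_apply, form]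

theorem form_dy_p (h : TwoRadiiHypersurface Ω X Ξ ρ r T R₁ R₂ m₁ m₂) {u : Euc n} (hu : u ∈ Ω)
    (v : Euc n) : formL n (dirD v (yMap X Ξ) u) (pVec n) = 0 := by
  rw [h.dirD_y hu]
  simp [formL_apply, form, pVec]

theorem form_y_p (u : Euc n) : formL n (yMap X Ξ u) (pVec n) = 0 := by
  simp [formL_apply, form, pVec, yMap]

theorem form_pointSphere_p (u : Euc n) : formL n (pointSphere X u) (pVec n) = -1 := by
  simp [formL_apply, form, pVec, pointSphere]
  ring

theorem form_pointSphere_y (u : Euc n) :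
    formL n (pointSphere X u) (yMap X Ξ u) = 0 := by
  simp [formL_apply, form, yMap, pointSphere]
  ring

theorem form_pointSphere_dy (h : TwoRadiiHypersurface Ω X Ξ ρ r T R₁ R₂ m₁ m₂) {u : Euc n}
    (hu : u ∈ Ω) (v : Euc n) : formL n (pointSphere X u) (dirD v (yMap X Ξ) u) = 0 := by
  rw [h.dirD_y hu]
  simp [formL_apply, form, pointSphere]
  ring

theorem smooth_confPos (h : TwoRadiiHypersurface Ω X Ξ ρ r T R₁ R₂ m₁ m₂) :
    ContDiffOn ℝ ∞ (confPos ρ X Ξ) Ω := h.smooth_dev.smul h.smooth_y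

theorem smooth_confNor (h : TwoRadiiHypersurface Ω X Ξ ρ r T R₁ R₂ m₁ m₂) :
    ContDiffOn ℝ ∞ (confNor r X Ξ) Ω := h.smooth_pointSphere.add (h.smooth_mean.smul h.smooth_y)

theorem dirD_confPos (h : TwoRadiiHypersurface Ω X Ξ ρ r T R₁ R₂ m₁ m₂) {u : Euc n} (hu : u ∈ Ω)
    (v : Euc n) : dirD v (confPos ρ X Ξ) u =
      ρ u • dirD v (yMap X Ξ) u + dirD v ρ u • yMap X Ξ u :=
  dirD_smul (differentiableAt_of_contDiffOn h.isOpen h.smooth_dev hu)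
    (differentiableAt_of_contDiffOn h.isOpen h.smooth_y hu) v

theorem dirD_confNor (h : TwoRadiiHypersurface Ω X Ξ ρ r T R₁ R₂ m₁ m₂) {u : Euc n} (hu : u ∈ Ω)
    (v : Euc n) : ∃ c : ℝ, dirD v (confNor r X Ξ) u =
      -dirD (conformalOperator ρ r T u v) (confPos ρ X Ξ) u + c • confPos ρ X Ξ u := by
  have dr := differentiableAt_of_contDiffOn h.isOpen h.smooth_mean hu
  have dy := differentiableAt_of_contDiffOn h.isOpen h.smooth_y hu
  have hρ := (h.dev_pos hu).ne'
  have hd : DifferentiableAt ℝ (fun w => r w • yMap X Ξ w) u := dr.smul dy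
  have e1 : dirD v (confNor r X Ξ) u = -dirD (T u v) (yMap X Ξ) u +
      (r u • dirD v (yMap X Ξ) u + dirD v r u • yMap X Ξ u) := by
    unfold confNor
    rw [dirD_add (differentiableAt_of_contDiffOn h.isOpen h.smooth_pointSphere hu)
      hd, h.dirD_pointSphere hu, dirD_smul dr dy]
  have e2 : dirD (T u v) (yMap X Ξ) u = ρ u • dirD (conformalOperator ρ r T u v) (yMap X Ξ) u +
      r u • dirD v (yMap X Ξ) u := by
    rw [← dirD_smul_dir, ← dirD_smul_dir, ← dirD_add_dir]
    congr 1
    simp only [conformalOperator, LinearMap.smul_apply, LinearMap.sub_apply, LinearMap.id_apply]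
    rw [smul_smul, mul_inv_cancel₀ hρ, one_smul, sub_add_cancel]
  refine ⟨(ρ u)⁻¹ * (dirD v r u + dirD (conformalOperator ρ r T u v) ρ u), ?_⟩
  rw [e1, e2, h.dirD_confPos hu, confPos]
  match_scalars <;> field_simp <;> ring

theorem form_confPos_confPos (h : TwoRadiiHypersurface Ω X Ξ ρ r T R₁ R₂ m₁ m₂) {u : Euc n}
    (hu : u ∈ Ω) : formL n (confPos ρ X Ξ u) (confPos ρ X Ξ u) = 0 := by
  simp [confPos, h.form_y_y hu]

theorem form_dPos_dPos (h : TwoRadiiHypersurface Ω X Ξ ρ r T R₁ R₂ m₁ m₂) {u : Euc n}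
    (hu : u ∈ Ω) (v w : Euc n) :
    formL n (dirD v (confPos ρ X Ξ) u) (dirD w (confPos ρ X Ξ) u) =
      ρ u ^ 2 * inner ℝ (dirD v Ξ u) (dirD w Ξ u) := by
  have hs : formL n (yMap X Ξ u) (dirD w (yMap X Ξ) u) = 0 := by
    rw [formL_apply, form_comm]; exact h.form_dy_y hu w
  rw [h.dirD_confPos hu, h.dirD_confPos hu]
  simp [h.form_y_y hu, h.form_dy_y hu, hs, h.form_dy_dy hu]
  ring

theorem form_dPos_pos (h : TwoRadiiHypersurface Ω X Ξ ρ r T R₁ R₂ m₁ m₂) {u : Euc n}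
    (hu : u ∈ Ω) (v : Euc n) :
    formL n (dirD v (confPos ρ X Ξ) u) (confPos ρ X Ξ u) = 0 := by
  rw [h.dirD_confPos hu, confPos]
  simp [h.form_y_y hu, h.form_dy_y hu]

theorem form_dPos_p (h : TwoRadiiHypersurface Ω X Ξ ρ r T R₁ R₂ m₁ m₂) {u : Euc n}
    (hu : u ∈ Ω) (v : Euc n) : formL n (dirD v (confPos ρ X Ξ) u) (pVec n) = 0 := by
  rw [h.dirD_confPos hu]
  simp [h.form_dy_p hu, form_y_p]

theorem form_pos_p (u : Euc n) : formL n (confPos ρ X Ξ u) (pVec n) = 0 := by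
  simp [confPos, form_y_p]

theorem form_nor_p (u : Euc n) : formL n (confNor r X Ξ u) (pVec n) = -1 := by
  simp [confNor, form_pointSphere_p, form_y_p]

theorem form_nor_pos (h : TwoRadiiHypersurface Ω X Ξ ρ r T R₁ R₂ m₁ m₂) {u : Euc n}
    (hu : u ∈ Ω) : formL n (confNor r X Ξ u) (confPos ρ X Ξ u) = 0 := by
  simp [confNor, confPos, form_pointSphere_y, h.form_y_y hu]

theorem form_nor_dPos (h : TwoRadiiHypersurface Ω X Ξ ρ r T R₁ R₂ m₁ m₂) {u : Euc n}
    (hu : u ∈ Ω) (v : Euc n) : formL n (confNor r X Ξ u) (dirD v (confPos ρ X Ξ) u) = 0 := by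
  have hs : formL n (yMap X Ξ u) (dirD v (yMap X Ξ) u) = 0 := by
    rw [formL_apply, form_comm]; exact h.form_dy_y hu v
  rw [h.dirD_confPos hu, confNor]
  simp [form_pointSphere_y, h.form_y_y hu, h.form_pointSphere_dy hu, hs]

theorem formL_comm (Z W : Amb n) : formL n Z W = formL n W Z := form_comm Z W

theorem confMetric_eq (h : TwoRadiiHypersurface Ω X Ξ ρ r T R₁ R₂ m₁ m₂) {u : Euc n}
    (hu : u ∈ Ω) : confMetric ρ X Ξ u =
      ρ u ^ 2 • Matrix.gram ℝ (fun k => dirD (stdVec k) Ξ u) := by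
  ext i j
  simp [confMetric, h.form_dy_dy hu]

theorem confMetric_apply (h : TwoRadiiHypersurface Ω X Ξ ρ r T R₁ R₂ m₁ m₂) {u : Euc n}
    (hu : u ∈ Ω) (i j : Fin n) : confMetric ρ X Ξ u i j =
      formL n (dirD (stdVec i) (confPos ρ X Ξ) u) (dirD (stdVec j) (confPos ρ X Ξ) u) := by
  rw [h.form_dPos_dPos hu, h.confMetric_eq hu]
  rfl

theorem det_confMetric_pos (h : TwoRadiiHypersurface Ω X Ξ ρ r T R₁ R₂ m₁ m₂) {u : Euc n}
    (hu : u ∈ Ω) : 0 < (confMetric ρ X Ξ u).det := by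
  rw [h.confMetric_eq hu, Matrix.det_smul]
  have := (h.posDef_gram hu).det_pos
  have := h.dev_pos hu
  positivity

theorem smooth_confMetric (h : TwoRadiiHypersurface Ω X Ξ ρ r T R₁ R₂ m₁ m₂) (i j : Fin n) :
    ContDiffOn ℝ ∞ (fun u => confMetric ρ X Ξ u i j) Ω :=
  ((h.smooth_dev.pow 2).mul (h.smooth_gram i j)).congr fun u hu => by
    rw [h.confMetric_eq hu]; rfl

theorem smooth_laplacian (h : TwoRadiiHypersurface Ω X Ξ ρ r T R₁ R₂ m₁ m₂) :
    ContDiffOn ℝ ∞ (laplacian (confMetric ρ X Ξ) (confPos ρ X Ξ)) Ω :=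
  contDiffOn_laplacian h.isOpen h.smooth_confMetric (fun _ hu => h.det_confMetric_pos hu)
    h.smooth_confPos

/-- If the part of `dZ` seen by `dY` is `dY ∘ S`, the metric trace of `⟨dY, dZ⟩` is `tr S`. The
choices `S = 0`, the identity and minus the conformal operator give the pairings with `P`, `Y` and
`η`; the last vanishes because that operator is trace-free. -/
theorem form_laplacian_of_orthogonal (h : TwoRadiiHypersurface Ω X Ξ ρ r T R₁ R₂ m₁ m₂)
    {Z : Euc n → Amb n} (hZ : ContDiffOn ℝ ∞ Z Ω)
    (horth : ∀ u ∈ Ω, ∀ v, formL n (dirD v (confPos ρ X Ξ) u) (Z u) = 0) {u : Euc n}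
    (hu : u ∈ Ω) (S : Euc n →ₗ[ℝ] Euc n)
    (hS : ∀ v w, formL n (dirD w (confPos ρ X Ξ) u) (dirD v Z u) =
      formL n (dirD w (confPos ρ X Ξ) u) (dirD (S v) (confPos ρ X Ξ) u)) :
    formL n (laplacian (confMetric ρ X Ξ) (confPos ρ X Ξ) u) (Z u) = -(stdMatrix S).trace := by
  rw [bilin_laplacian_of_orthogonal (formL n) h.isOpen h.smooth_confMetric
    (fun _ hu => h.det_confMetric_pos hu) h.smooth_confPos hZ horth hu]
  congr 1
  have e : ((confMetric ρ X Ξ u)⁻¹ * (confMetric ρ X Ξ u * stdMatrix S)).trace =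
      (stdMatrix S).trace := by
    rw [← Matrix.mul_assoc, Matrix.nonsing_inv_mul _ (h.det_confMetric_pos hu).ne'.isUnit,
      Matrix.one_mul]
  rw [← e, Matrix.trace]
  refine Finset.sum_congr rfl fun i _ => ?_
  rw [Matrix.diag_apply, Matrix.mul_apply]
  refine Finset.sum_congr rfl fun j _ => ?_
  rw [hS, dirD_apply_stdVec, map_sum, Matrix.mul_apply]
  congr 1
  refine Finset.sum_congr rfl fun k _ => ?_
  rw [map_smul, h.confMetric_apply hu, smul_eq_mul, mul_comm]

theorem form_laplacian_p (h : TwoRadiiHypersurface Ω X Ξ ρ r T R₁ R₂ m₁ m₂) {u : Euc n}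
    (hu : u ∈ Ω) :
    formL n (laplacian (confMetric ρ X Ξ) (confPos ρ X Ξ) u) (pVec n) = 0 := by
  rw [h.form_laplacian_of_orthogonal (Z := fun _ => pVec n) contDiffOn_const
    (fun u hu v => h.form_dPos_p hu v) hu 0 (fun v w => by simp [dirD])]
  simp [stdMatrix]

theorem form_laplacian_pos (h : TwoRadiiHypersurface Ω X Ξ ρ r T R₁ R₂ m₁ m₂) {u : Euc n}
    (hu : u ∈ Ω) :
    formL n (laplacian (confMetric ρ X Ξ) (confPos ρ X Ξ) u) (confPos ρ X Ξ u) = -n := by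
  rw [h.form_laplacian_of_orthogonal h.smooth_confPos
    (fun u hu v => h.form_dPos_pos hu v) hu LinearMap.id (fun v w => rfl), ← trace_eq_stdMatrix,
    LinearMap.trace_id, finrank_euclideanSpace_fin]

theorem form_laplacian_nor (h : TwoRadiiHypersurface Ω X Ξ ρ r T R₁ R₂ m₁ m₂) {u : Euc n}
    (hu : u ∈ Ω) :
    formL n (laplacian (confMetric ρ X Ξ) (confPos ρ X Ξ) u) (confNor r X Ξ u) = 0 := by
  rw [h.form_laplacian_of_orthogonal h.smooth_confNor
    (fun u hu v => by rw [formL_comm]; exact h.form_nor_dPos hu v) hu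
    (-conformalOperator ρ r T u) (fun v w => ?_), ← trace_eq_stdMatrix, map_neg,
    trace_eq_stdMatrix, h.trace_conformalOperator hu, neg_zero, neg_zero]
  obtain ⟨c, hc⟩ := h.dirD_confNor hu v
  rw [hc, map_add, map_smul, h.form_dPos_pos hu, smul_zero, add_zero]
  simp [dirD]

theorem form_laplacian_dPos (h : TwoRadiiHypersurface Ω X Ξ ρ r T R₁ R₂ m₁ m₂) {u : Euc n}
    (hu : u ∈ Ω) (k : Fin n) :
    formL n (laplacian (confMetric ρ X Ξ) (confPos ρ X Ξ) u)
      (dirD (stdVec k) (confPos ρ X Ξ) u) = 0 :=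
  bilin_laplacian_dirD (formL n) formL_comm h.isOpen h.smooth_confMetric
    (fun _ hu => h.det_confMetric_pos hu) h.smooth_confPos
    (fun _ hu => h.confMetric_apply hu) hu k

theorem smooth_confN (h : TwoRadiiHypersurface Ω X Ξ ρ r T R₁ R₂ m₁ m₂) :
    ContDiffOn ℝ ∞ (confN ρ X Ξ) Ω := by
  have hL := h.smooth_laplacian
  have hq : ContDiffOn ℝ ∞ (fun u => formL n (laplacian (confMetric ρ X Ξ) (confPos ρ X Ξ) u)
      (laplacian (confMetric ρ X Ξ) (confPos ρ X Ξ) u)) Ω :=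
    (((formL n).contDiff.comp_contDiffOn hL).clm_apply hL)
  exact (hL.const_smul (1 / (n : ℝ))).add ((contDiffOn_const.mul hq).smul h.smooth_confPos)

theorem form_N_p (h : TwoRadiiHypersurface Ω X Ξ ρ r T R₁ R₂ m₁ m₂) {u : Euc n}
    (hu : u ∈ Ω) : formL n (confN ρ X Ξ u) (pVec n) = 0 := by
  simp [confN, h.form_laplacian_p hu, form_pos_p]

theorem form_N_pos (h : TwoRadiiHypersurface Ω X Ξ ρ r T R₁ R₂ m₁ m₂) {u : Euc n}
    (hu : u ∈ Ω) : formL n (confN ρ X Ξ u) (confPos ρ X Ξ u) = -1 := by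
  have hn := (h.cast_pos hu).2.2.ne'
  simp [confN, h.form_laplacian_pos hu, h.form_confPos_confPos hu, hn]

theorem form_N_dPos (h : TwoRadiiHypersurface Ω X Ξ ρ r T R₁ R₂ m₁ m₂) {u : Euc n}
    (hu : u ∈ Ω) (k : Fin n) :
    formL n (confN ρ X Ξ u) (dirD (stdVec k) (confPos ρ X Ξ) u) = 0 := by
  have := h.form_dPos_pos hu (stdVec k)
  rw [formL_comm] at this
  simp [confN, h.form_laplacian_dPos hu, this]

theorem form_N_nor (h : TwoRadiiHypersurface Ω X Ξ ρ r T R₁ R₂ m₁ m₂) {u : Euc n}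
    (hu : u ∈ Ω) : formL n (confN ρ X Ξ u) (confNor r X Ξ u) = 0 := by
  have := h.form_nor_pos hu
  rw [formL_comm] at this
  simp [confN, h.form_laplacian_nor hu, this]

/-- The coefficient `1 / (2n²)` in `N` is what makes it null, given `⟨ΔY, Y⟩ = -n`. -/
theorem form_N_N (h : TwoRadiiHypersurface Ω X Ξ ρ r T R₁ R₂ m₁ m₂) {u : Euc n}
    (hu : u ∈ Ω) : formL n (confN ρ X Ξ u) (confN ρ X Ξ u) = 0 := by
  have hn := (h.cast_pos hu).2.2.ne'
  have := h.form_laplacian_pos hu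
  rw [formL_comm] at this
  simp only [confN, map_add, map_smul, add_apply, smul_apply, this, h.form_laplacian_pos hu,
    h.form_confPos_confPos hu, smul_eq_mul]
  field_simp
  ring

/-- A vector orthogonal to `P` and `Y` lies in the span of `dY`, `P` and `Y`. -/
theorem exists_decomposition (h : TwoRadiiHypersurface Ω X Ξ ρ r T R₁ R₂ m₁ m₂) {u : Euc n}
    (hu : u ∈ Ω) {W : Amb n} (hP : formL n W (pVec n) = 0)
    (hY : formL n W (confPos ρ X Ξ u) = 0) :
    ∃ v, ∃ c d : ℝ, W = dirD v (confPos ρ X Ξ) u + c • pVec n + d • confPos ρ X Ξ u := by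
  have hρ := (h.dev_pos hu).ne'
  obtain ⟨a, a', ζ, τ⟩ := W
  have ha : a' = -a := by
    simp [formL_apply, form, pVec] at hP
    linarith
  subst ha
  have hτ : inner ℝ (Ξ u) ζ = τ := by
    simp only [confPos, map_smul, smul_eq_mul, mul_eq_zero, hρ, false_or] at hY
    simp [formL_apply, form, yMap] at hY
    rw [real_inner_comm]
    linarith
  have hdim : Module.finrank ℝ (Euc (n + 1)) = Module.finrank ℝ (Euc n) + 1 := by simp
  have hr := range_eq_orthogonal_of_injective (Ξ := (fderiv ℝ Ξ u).toLinearMap) hdim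
    (ν := Ξ u) (norm_ne_zero_iff.1 (by rw [h.unit u hu]; exact one_ne_zero)) (h.inj u hu)
    (fun v => h.normal_dΞ hu v)
  have hm : ζ - τ • Ξ u ∈ LinearMap.range (fderiv ℝ Ξ u).toLinearMap := by
    rw [hr, Submodule.mem_orthogonal_singleton_iff_inner_right, inner_sub_right, inner_smul_right,
      real_inner_self_eq_norm_sq, h.unit u hu, hτ]
    ring
  obtain ⟨v, hv⟩ := hm
  have hv' : dirD v Ξ u = ζ - τ • Ξ u := hv
  -- The tangential part of `ζ` determines `v`. The factor `ρ⁻¹` undoes the scaling of `dY`, the `Y`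
  -- coefficient corrects for the `dρ` term, and the `P` coefficient is what is left in the first
  -- slot.
  refine ⟨(ρ u)⁻¹ • v, a - inner ℝ (X u) (dirD v Ξ u) - τ * inner ℝ (X u) (Ξ u),
    (ρ u)⁻¹ * (τ - dirD ((ρ u)⁻¹ • v) ρ u), ?_⟩
  have e : dirD ((ρ u)⁻¹ • v) (confPos ρ X Ξ) u =
      dirD v (yMap X Ξ) u + dirD ((ρ u)⁻¹ • v) ρ u • yMap X Ξ u := by
    rw [h.dirD_confPos hu, dirD_smul_dir _ _ (yMap X Ξ), smul_smul, mul_inv_cancel₀ hρ, one_smul]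
  have e' : ((ρ u)⁻¹ * (τ - dirD ((ρ u)⁻¹ • v) ρ u)) • confPos ρ X Ξ u =
      (τ - dirD ((ρ u)⁻¹ • v) ρ u) • yMap X Ξ u := by
    rw [confPos, smul_smul]
    congr 1
    field_simp
  rw [e, e', h.dirD_y hu]
  have hsum : ((a, -a, ζ, τ) : Amb n) =
      (inner ℝ (X u) (dirD v Ξ u), -inner ℝ (X u) (dirD v Ξ u), dirD v Ξ u, 0)
      + (a - inner ℝ (X u) (dirD v Ξ u) - τ * inner ℝ (X u) (Ξ u)) • pVec n + τ • yMap X Ξ u := by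
    simp only [pVec, yMap, Prod.smul_mk, Prod.mk_add_mk, smul_eq_mul]
    refine Prod.ext ?_ (Prod.ext ?_ (Prod.ext ?_ ?_)) <;> simp only
    · ring
    · ring
    · rw [hv']; simp
    · ring
  rw [hsum]
  module

/-- Vanishing of the Laguerre form and proportionality of the Laguerre tensor to the metric mean
`dN = lam dY`. -/
theorem dirD_N (h : TwoRadiiHypersurface Ω X Ξ ρ r T R₁ R₂ m₁ m₂) {lam : ℝ} {u : Euc n}
    (hu : u ∈ Ω) {i : Fin n} (hC : formL n (dirD (stdVec i) (confN ρ X Ξ) u) (confNor r X Ξ u) = 0)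
    (hL : ∀ j, formL n (dirD (stdVec i) (confN ρ X Ξ) u) (dirD (stdVec j) (confPos ρ X Ξ) u) =
      lam * confMetric ρ X Ξ u i j) :
    dirD (stdVec i) (confN ρ X Ξ) u = lam • dirD (stdVec i) (confPos ρ X Ξ) u := by
  have hρ := (h.dev_pos hu).ne'
  have hNY := dirD_bilin_const (formL n) h.isOpen h.smooth_confN h.smooth_confPos
    (fun w hw => h.form_N_pos hw) hu (stdVec i)
  have hNN := dirD_bilin_const (formL n) h.isOpen h.smooth_confN h.smooth_confN
    (fun w hw => h.form_N_N hw) hu (stdVec i)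
  have hNP := dirD_bilin_const (formL n) h.isOpen h.smooth_confN (g := fun _ => pVec n)
    contDiffOn_const (fun w hw => h.form_N_p hw) hu (stdVec i)
  rw [h.form_N_dPos hu, add_zero] at hNY
  rw [formL_comm (confN ρ X Ξ u)] at hNN
  have hNP' : formL n (dirD (stdVec i) (confN ρ X Ξ) u) (pVec n) = 0 := by
    simpa [dirD] using hNP
  set D := dirD (stdVec i) (confN ρ X Ξ) u with hD
  set Yi := dirD (stdVec i) (confPos ρ X Ξ) u with hYi
  have hYN : formL n Yi (confN ρ X Ξ u) = 0 := by rw [formL_comm]; exact h.form_N_dPos hu i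
  have hYn : formL n Yi (confNor r X Ξ u) = 0 := by rw [formL_comm]; exact h.form_nor_dPos hu _
  -- Once the difference is decomposed, pairing with `N`, `dY` and `η` removes the `Y`, `dY` and `P`
  -- components in turn.
  obtain ⟨v, c, d, hZ⟩ := h.exists_decomposition hu (W := D - lam • Yi)
    (by rw [map_sub, map_smul, sub_apply, smul_apply, hNP', h.form_dPos_p hu]; simp)
    (by rw [map_sub, map_smul, sub_apply, smul_apply, hNY, h.form_dPos_pos hu]; simp)
  have hvN : ∀ v, formL n (dirD v (confPos ρ X Ξ) u) (confN ρ X Ξ u) = 0 := by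
    intro v
    have e : v = ∑ k, v k • stdVec k := by
      simpa [stdVec] using ((EuclideanSpace.basisFun (Fin n) ℝ).toBasis.sum_repr v).symm
    rw [e]
    simp only [dirD, map_sum, map_smul, sum_apply, smul_apply]
    refine Finset.sum_eq_zero fun k _ => ?_
    rw [formL_comm]
    have := h.form_N_dPos hu k
    unfold dirD at this
    rw [this, smul_zero]
  have hd : d = 0 := by
    have h1 : formL n (D - lam • Yi) (confN ρ X Ξ u) = 0 := by
      rw [map_sub, map_smul, sub_apply, smul_apply, hYN]
      simp only [smul_zero, sub_zero]
      linarith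
    rw [hZ] at h1
    simp only [map_add, map_smul, add_apply, smul_apply, hvN, formL_comm (pVec n), h.form_N_p hu,
      formL_comm (confPos ρ X Ξ u), h.form_N_pos hu, smul_eq_mul] at h1
    linarith
  have hv : v = 0 := by
    have hj : ∀ w, formL n (D - lam • Yi) (dirD w (confPos ρ X Ξ) u) = 0 := by
      intro w
      have e : w = ∑ k, w k • stdVec k := by
        simpa [stdVec] using ((EuclideanSpace.basisFun (Fin n) ℝ).toBasis.sum_repr w).symm
      rw [e]
      simp only [dirD, map_sum, map_smul]
      refine Finset.sum_eq_zero fun k _ => ?_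
      have := hL k
      rw [h.confMetric_apply hu] at this
      change w k • formL n (D - lam • Yi) (dirD (stdVec k) (confPos ρ X Ξ) u) = 0
      rw [map_sub, map_smul, sub_apply, smul_apply, this]
      simp [hYi]
    have h1 := hj v
    rw [hZ] at h1
    simp only [map_add, map_smul, add_apply, smul_apply, formL_comm (pVec n), h.form_dPos_p hu,
      formL_comm (confPos ρ X Ξ u), h.form_dPos_pos hu, h.form_dPos_dPos hu, smul_eq_mul,
      mul_zero, add_zero, mul_eq_zero, pow_eq_zero_iff, ne_eq, OfNat.ofNat_ne_zero,
      not_false_eq_true, hρ, false_or, inner_self_eq_zero] at h1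
    exact h.inj u hu (by rw [map_zero]; exact h1)
  have hv0 : dirD v (confPos ρ X Ξ) u = 0 := by simp [hv, dirD]
  rw [hv0, hd, zero_smul, zero_add, add_zero] at hZ
  have hc : c = 0 := by
    have h1 : formL n (D - lam • Yi) (confNor r X Ξ u) = 0 := by
      rw [map_sub, map_smul, sub_apply, smul_apply, hYn, hC]
      simp
    rw [hZ, map_smul, smul_apply, formL_comm, form_nor_p] at h1
    simpa using h1
  rw [hc, zero_smul] at hZ
  exact sub_eq_zero.1 hZ

/-- Integrating `dN = lam dY` yields the constant vector `A`, which supplies an `IsotropicPair`; its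
Gauss equation is then evaluated on one eigenvector for each radius. -/
theorem isotropic_constant_eq_zero (h : TwoRadiiHypersurface Ω X Ξ ρ r T R₁ R₂ m₁ m₂)
    (hconn : IsPreconnected Ω) (hne : Ω.Nonempty) {lam : ℝ}
    (hC : ∀ u ∈ Ω, ∀ i, formL n (dirD (stdVec i) (confN ρ X Ξ) u) (confNor r X Ξ u) = 0)
    (hL : ∀ u ∈ Ω, ∀ i j, formL n (dirD (stdVec i) (confN ρ X Ξ) u)
      (dirD (stdVec j) (confPos ρ X Ξ) u) = lam * confMetric ρ X Ξ u i j) : lam = 0 := by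
  obtain ⟨s, hs⟩ := h.conformalSum_const hconn
  have dN := fun u hu => differentiableAt_of_contDiffOn h.isOpen h.smooth_confN (u := u) hu
  have dY := fun u hu => differentiableAt_of_contDiffOn h.isOpen h.smooth_confPos (u := u) hu
  obtain ⟨A, hA⟩ := h.isOpen.exists_is_const_of_fderiv_eq_zero (𝕜 := ℝ) hconn
    (f := fun u => confN ρ X Ξ u - lam • confPos ρ X Ξ u)
    (fun u hu => ((dN u hu).sub ((dY u hu).const_smul lam)).differentiableWithinAt)
    (fun u hu => by
      have dY' : DifferentiableAt ℝ (fun u => lam • confPos ρ X Ξ u) u := (dY u hu).const_smul lam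
      rw [fderiv_fun_sub (dN u hu) dY', fderiv_fun_const_smul (dY u hu)]
      ext1 v
      have e : v = ∑ k, v k • stdVec k := by
        simpa [stdVec] using ((EuclideanSpace.basisFun (Fin n) ℝ).toBasis.sum_repr v).symm
      rw [e, map_sum]
      refine Finset.sum_eq_zero fun k _ => ?_
      rw [map_smul, sub_apply, smul_apply]
      have := h.dirD_N hu (hC u hu k) (hL u hu k)
      unfold dirD at this
      rw [this, sub_self, smul_zero])
  have hYA : ∀ u ∈ Ω, formL n (confPos ρ X Ξ u) A = -1 := by
    intro u hu
    rw [← hA u hu, map_sub, map_smul, h.form_confPos_confPos hu, formL_comm, h.form_N_pos hu]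
    simp
  have hηA : ∀ u ∈ Ω, formL n (confNor r X Ξ u) A = 0 := by
    intro u hu
    rw [← hA u hu, map_sub, map_smul, h.form_nor_pos hu, formL_comm, h.form_N_nor hu]
    simp
  obtain ⟨u₀, hu₀⟩ := hne
  have hAP : formL n A (pVec n) = 0 := by
    rw [← hA u₀ hu₀, map_sub, map_smul, sub_apply, smul_apply, h.form_N_p hu₀, form_pos_p]
    simp
  have hAA : formL n A A = 2 * lam := by
    have e1 : formL n A A = formL n (confN ρ X Ξ u₀) A - lam * formL n (confPos ρ X Ξ u₀) A := by
      have := congrArg (fun Z => formL n Z A) (hA u₀ hu₀)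
      simp only [map_sub, map_smul, sub_apply, smul_apply, smul_eq_mul] at this
      exact this.symm
    rw [e1, hYA u₀ hu₀, ← hA u₀ hu₀, map_sub, map_smul, h.form_N_N hu₀, h.form_N_pos hu₀]
    simp
    ring
  have hdYA : ∀ u ∈ Ω, ∀ v, formL n (dirD v (confPos ρ X Ξ) u) A = 0 := by
    intro u hu v
    have := dirD_bilin_const (formL n) h.isOpen h.smooth_confPos (g := fun _ => A)
      contDiffOn_const hYA hu v
    simpa [dirD] using this
  have hdηA : ∀ u ∈ Ω, ∀ v, formL n (dirD v (confNor r X Ξ) u) A = 0 := by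
    intro u hu v
    have := dirD_bilin_const (formL n) h.isOpen h.smooth_confNor (g := fun _ => A)
      contDiffOn_const hηA hu v
    simpa [dirD] using this
  have hdη : ∀ u ∈ Ω, ∀ v, dirD v (confNor r X Ξ) u =
      -dirD (conformalOperator ρ r T u v) (confPos ρ X Ξ) u := by
    intro u hu v
    -- Pairing with `A` detects the `Y` component of `dη`, since `⟨Y, A⟩ = -1` while `⟨dη, A⟩` and
    -- `⟨dY, A⟩` vanish.
    obtain ⟨c, hc⟩ := h.dirD_confNor hu v
    have h1 := hdηA u hu v
    rw [hc, map_add, map_neg, map_smul, add_apply, neg_apply, smul_apply, hdYA u hu,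
      hYA u hu] at h1
    have hc0 : c = 0 := by simpa using h1
    rw [hc, hc0, zero_smul, add_zero]
  have hn := (h.cast_pos hu₀).2.2
  have hpair : IsotropicPair (formL n) Ω (confPos ρ X Ξ) (confNor r X Ξ) A (pVec n)
      (conformalOperator ρ r T) lam s (1 / n) :=
    { symm := formL_comm
      isOpen := h.isOpen
      smooth_Y := h.smooth_confPos
      smooth_η := h.smooth_confNor
      AA := hAA
      YY := fun u hu => h.form_confPos_confPos hu
      YA := hYA
      YP := fun u _ => form_pos_p u
      AP := hAP
      ηY := fun u hu => h.form_nor_pos hu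
      ηP := fun u _ => form_nor_p u
      ηA := hηA
      ηdY := fun u hu v => h.form_nor_dPos hu v
      dη := hdη
      quadratic := fun u hu v => by rw [h.conformalOperator_quadratic hu, hs u hu]
      -- Here the discriminant is `s² / 4 + 1/n`.
      disc := by positivity
      span := fun u hu W hWY hWA hWP => by
        obtain ⟨v, c, d, hW⟩ := h.exists_decomposition hu hWP hWY
        rw [hW, map_add, map_add, map_smul, map_smul, add_apply, add_apply, smul_apply, smul_apply,
          hdYA u hu, formL_comm (pVec n), hAP, hYA u hu] at hWA
        have hd : d = 0 := by simpa using hWA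
        exact ⟨v, c, by rw [hW, hd, zero_smul, add_zero]⟩ }
  have hrad := h.radii u₀ hu₀
  have hρ := (h.dev_pos hu₀).ne'
  have eig : ∀ R v, T u₀ v = R • v → formL n (dirD v (confNor r X Ξ) u₀)
      (dirD v (confPos ρ X Ξ) u₀) = -((ρ u₀)⁻¹ * (R - r u₀)) *
        formL n (dirD v (confPos ρ X Ξ) u₀) (dirD v (confPos ρ X Ξ) u₀) := by
    intro R v hv
    have e : conformalOperator ρ r T u₀ v = ((ρ u₀)⁻¹ * (R - r u₀)) • v := by
      simp only [conformalOperator, LinearMap.smul_apply, LinearMap.sub_apply, LinearMap.id_apply,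
        hv]
      rw [← sub_smul, smul_smul]
    rw [hdη u₀ hu₀, e, dirD_smul_dir, map_neg, neg_apply, map_smul, smul_apply, smul_eq_mul]
    ring
  have pos : ∀ v, v ≠ 0 →
      0 < formL n (dirD v (confPos ρ X Ξ) u₀) (dirD v (confPos ρ X Ξ) u₀) := by
    intro v hv
    rw [h.form_dPos_dPos hu₀, real_inner_self_eq_norm_sq]
    have : dirD v Ξ u₀ ≠ 0 := fun h0 => hv (h.inj u₀ hu₀ (by rw [map_zero]; exact h0))
    positivity
  obtain ⟨v₁, hv₁, e₁⟩ := hrad.exists₁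
  obtain ⟨v₂, hv₂, e₂⟩ := hrad.exists₂
  have g := hpair.gauss hu₀ v₁ v₂
  rw [eig _ _ e₁, eig _ _ e₂] at g
  have p := mul_pos (pos v₁ hv₁) (pos v₂ hv₂)
  have key : lam * ((ρ u₀)⁻¹ * (R₁ u₀ - R₂ u₀) *
      (formL n (dirD v₁ (confPos ρ X Ξ) u₀) (dirD v₁ (confPos ρ X Ξ) u₀) *
        formL n (dirD v₂ (confPos ρ X Ξ) u₀) (dirD v₂ (confPos ρ X Ξ) u₀))) = 0 := by
    linear_combination g
  exact (mul_eq_zero.1 key).resolve_right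
    (mul_ne_zero (mul_ne_zero (inv_ne_zero hρ) (sub_ne_zero.2 hrad.ne)) p.ne')

end TwoRadiiHypersurface

/-! ### Passage from the manifold to charts -/

section Chart

variable {n : ℕ} {M : Type*} [TopologicalSpace M] [ChartedSpace (Euc n) M]
  [IsManifold (𝓡 n) ∞ M] {φ : OpenPartialHomeomorph M (Euc n)}

theorem contDiffOn_comp_chart_symm (hφ : φ ∈ atlas (Euc n) M) {m : ℕ} {f : M → Euc m}
    (hf : ContMDiff (𝓡 n) 𝓘(ℝ, Euc m) ∞ f) : ContDiffOn ℝ ∞ (f ∘ φ.symm) φ.target := by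
  rw [← contMDiffOn_iff_contDiffOn]
  exact hf.comp_contMDiffOn (contMDiffOn_symm_of_mem_maximalAtlas
    (IsManifold.subset_maximalAtlas hφ))

/-- The coordinate isomorphism from `ℝ^n` to a tangent space of `M`. -/
theorem exists_coordinateEquiv (hφ : φ ∈ atlas (Euc n) M) {u : Euc n} (hu : u ∈ φ.target) :
    ∃ J : Euc n ≃ₗ[ℝ] TangentSpace (𝓡 n) (φ.symm u), ∀ (m : ℕ) (f : M → Euc m),
      ContMDiff (𝓡 n) 𝓘(ℝ, Euc m) ∞ f →
        ∀ v, diff n f (φ.symm u) (J v) = fderiv ℝ (f ∘ φ.symm) u v := by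
  have : IsManifold (𝓡 n) 1 M := IsManifold.of_le (n := ∞) (by simp)
  have hm := mdifferentiable_of_mem_atlas (I := 𝓡 n) hφ
  have hb := hm.symm.mfderiv_bijective (x := u) hu
  refine ⟨LinearEquiv.ofBijective
    (mfderiv (𝓡 n) (𝓡 n) φ.symm u).toLinearMap hb, fun m f hf v => ?_⟩
  have hd : MDifferentiableAt (𝓡 n) 𝓘(ℝ, Euc m) f (φ.symm u) :=
    (hf (φ.symm u)).mdifferentiableAt (by simp)
  have hc := mfderiv_comp (I := 𝓡 n) (I' := 𝓡 n) (I'' := 𝓘(ℝ, Euc m)) u hd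
    (hm.symm.mdifferentiableAt hu)
  rw [← mfderiv_eq_fderiv]
  exact (congrArg (fun L => L v) hc).symm

theorem finrank_ker_comp_equiv {V W E : Type*} [AddCommGroup V] [Module ℝ V] [AddCommGroup W]
    [Module ℝ W] [AddCommGroup E] [Module ℝ E] (J : V ≃ₗ[ℝ] W) (f : W →ₗ[ℝ] E) :
    Module.finrank ℝ (LinearMap.ker (f ∘ₗ J.toLinearMap)) =
      Module.finrank ℝ (LinearMap.ker f) := by
  rw [LinearMap.ker_comp]
  exact (J.submoduleMap ((LinearMap.ker f).comap J.toLinearMap)).finrank_eq.trans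
    (by rw [Submodule.map_comap_eq_of_surjective J.surjective])

variable {x ξ : M → Euc (n + 1)} {lam : ℝ}

theorem multiplicity_eq_chart (hφ : φ ∈ atlas (Euc n) M) (h : IsOrientedHypersurface x ξ)
    {u : Euc n} (hu : u ∈ φ.target) (k : ℝ) :
    multiplicity x ξ (φ.symm u) k = Module.finrank ℝ (LinearMap.ker
      ((fderiv ℝ (ξ ∘ φ.symm) u).toLinearMap + k • (fderiv ℝ (x ∘ φ.symm) u).toLinearMap)) := by
  obtain ⟨J, hJ⟩ := exists_coordinateEquiv hφ hu
  rw [multiplicity, principalSpace, ← finrank_ker_comp_equiv J]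
  have e : (diff n ξ (φ.symm u) + k • diff n x (φ.symm u)) ∘ₗ J.toLinearMap =
      (fderiv ℝ (ξ ∘ φ.symm) u).toLinearMap + k • (fderiv ℝ (x ∘ φ.symm) u).toLinearMap := by
    ext1 v
    change diff n ξ (φ.symm u) (J v) + k • diff n x (φ.symm u) (J v) = _
    rw [hJ _ _ h.smooth, hJ _ _ h.smooth_normal]
    rfl
  rw [e]

theorem principalCurvatures_eq_chart (hφ : φ ∈ atlas (Euc n) M) (h : IsOrientedHypersurface x ξ)
    {u : Euc n} (hu : u ∈ φ.target) :
    principalCurvatures x ξ (φ.symm u) = {k : ℝ | ∃ v : Euc n, v ≠ 0 ∧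
      (fderiv ℝ (ξ ∘ φ.symm) u).toLinearMap v =
        -(k • (fderiv ℝ (x ∘ φ.symm) u).toLinearMap v)} := by
  obtain ⟨J, hJ⟩ := exists_coordinateEquiv hφ hu
  ext k
  constructor
  · rintro ⟨w, hw, e⟩
    obtain ⟨v, rfl⟩ := J.surjective w
    rw [hJ _ _ h.smooth, hJ _ _ h.smooth_normal] at e
    exact ⟨v, fun h0 => hw (by rw [h0, map_zero]), e⟩
  · rintro ⟨v, hv, e⟩
    refine ⟨J v, fun h0 => hv (J.map_eq_zero_iff.1 h0), ?_⟩
    rw [hJ _ _ h.smooth, hJ _ _ h.smooth_normal]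
    exact e

theorem normal_chart (hφ : φ ∈ atlas (Euc n) M) (h : IsOrientedHypersurface x ξ) {u : Euc n}
    (hu : u ∈ φ.target) (v : Euc n) :
    inner ℝ ((ξ ∘ φ.symm) u) (dirD v (x ∘ φ.symm) u) = 0 := by
  obtain ⟨J, hJ⟩ := exists_coordinateEquiv hφ hu
  have := h.normal (φ.symm u) (J v)
  rwa [hJ _ _ h.smooth] at this

theorem normal_chart' (hφ : φ ∈ atlas (Euc n) M) (h : IsOrientedHypersurface x ξ) {u : Euc n}
    (hu : u ∈ φ.target) (v : Euc n) :
    inner ℝ ((ξ ∘ φ.symm) u) (dirD v (ξ ∘ φ.symm) u) = 0 :=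
  inner_dirD_of_unit φ.open_target (contDiffOn_comp_chart_symm hφ h.smooth_normal)
    (fun _ _ => h.unit _) hu v

theorem immersion_chart (hφ : φ ∈ atlas (Euc n) M) (h : IsOrientedHypersurface x ξ) {u : Euc n}
    (hu : u ∈ φ.target) : Function.Injective (fderiv ℝ (x ∘ φ.symm) u) := by
  intro v w hvw
  obtain ⟨J, hJ⟩ := exists_coordinateEquiv hφ hu
  rw [← hJ _ _ h.smooth, ← hJ _ _ h.smooth] at hvw
  exact J.injective (h.immersion _ hvw)

theorem injective_normal_chart (hφ : φ ∈ atlas (Euc n) M) (h : IsOrientedHypersurface x ξ)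
    (h0 : ∀ p, (0 : ℝ) ∉ principalCurvatures x ξ p) {u : Euc n} (hu : u ∈ φ.target) :
    Function.Injective (fderiv ℝ (ξ ∘ φ.symm) u) := by
  rw [injective_iff_map_eq_zero]
  intro v hv
  by_contra hv0
  apply h0 (φ.symm u)
  rw [principalCurvatures_eq_chart hφ h hu]
  exact ⟨v, hv0, by simpa using hv⟩

/-- The second fundamental form is symmetric. -/
theorem second_form_symm_chart (hφ : φ ∈ atlas (Euc n) M) (h : IsOrientedHypersurface x ξ)
    {u : Euc n} (hu : u ∈ φ.target) (v w : Euc n) :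
    inner ℝ (dirD v (ξ ∘ φ.symm) u) (dirD w (x ∘ φ.symm) u) =
      inner ℝ (dirD v (x ∘ φ.symm) u) (dirD w (ξ ∘ φ.symm) u) := by
  have hopen := φ.open_target
  have sX := contDiffOn_comp_chart_symm hφ h.smooth
  have sΞ := contDiffOn_comp_chart_symm hφ h.smooth_normal
  have e : ∀ v w, inner ℝ (dirD v (ξ ∘ φ.symm) u) (dirD w (x ∘ φ.symm) u) +
      inner ℝ ((ξ ∘ φ.symm) u) (dirD v (dirD w (x ∘ φ.symm)) u) = 0 := by
    intro v w
    have h0 := dirD_eq_zero_of_const hopen (fun z hz => normal_chart hφ h hz w) hu v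
    have h1 := fderiv_inner_apply ℝ (differentiableAt_of_contDiffOn hopen sΞ hu)
      (differentiableAt_of_contDiffOn hopen (contDiffOn_dirD hopen sX w) hu) v
    rw [add_comm]
    exact h1.symm.trans h0
  have e1 := e v w
  have e2 := e w v
  rw [dirD_comm hopen sX hu w v] at e2
  rw [real_inner_comm (dirD w (ξ ∘ φ.symm) u)]
  linarith

theorem exists_radiusOperator_chart (hφ : φ ∈ atlas (Euc n) M) (h : IsOrientedHypersurface x ξ)
    (h0 : ∀ p, (0 : ℝ) ∉ principalCurvatures x ξ p) {u : Euc n} (hu : u ∈ φ.target) :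
    ∃ T : Euc n →ₗ[ℝ] Euc n, ∀ v, dirD v (x ∘ φ.symm) u = -dirD (T v) (ξ ∘ φ.symm) u :=
  exists_radiusOperator (X := (fderiv ℝ (x ∘ φ.symm) u).toLinearMap)
    (Ξ := (fderiv ℝ (ξ ∘ φ.symm) u).toLinearMap) (ν := (ξ ∘ φ.symm) u) (by simp)
    (norm_ne_zero_iff.1 (by rw [Function.comp_apply, h.unit]; exact one_ne_zero))
    (injective_normal_chart hφ h h0 hu) (normal_chart' hφ h hu) (normal_chart hφ h hu)

/-- A symmetric operator with at most one eigenvalue is scalar, so fewer than two curvatures would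
produce an umbilic point. -/
theorem IsLIsotropic.two_le_encard (hx : IsLIsotropic x ξ lam) (p : M) :
    2 ≤ (principalCurvatures x ξ p).encard := by
  have h := hx.hypersurface
  obtain ⟨φ, hφ, u, hu, rfl⟩ : ∃ φ ∈ atlas (Euc n) M, ∃ u ∈ φ.target, φ.symm u = p :=
    ⟨chartAt (Euc n) p, chart_mem_atlas _ _, chartAt (Euc n) p p, mem_chart_target _ _,
      (chartAt (Euc n) p).left_inv (mem_chart_source _ _)⟩
  by_contra! hlt
  rw [principalCurvatures_eq_chart hφ h hu] at hlt
  obtain ⟨T, hT⟩ := exists_radiusOperator_chart hφ h hx.nonvanishing hu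
  obtain ⟨k, hk⟩ := exists_umbilic_of_encard_lt_two
    (injective_normal_chart hφ h hx.nonvanishing hu) (immersion_chart hφ h hu) hT
    (second_form_symm_chart hφ h hu) hlt
  refine hx.umbilic_free (φ.symm u) ⟨k, fun w => ?_⟩
  obtain ⟨J, hJ⟩ := exists_coordinateEquiv hφ hu
  obtain ⟨v, rfl⟩ := J.surjective w
  rw [hJ _ _ h.smooth, hJ _ _ h.smooth_normal]
  exact hk v

/-- An L-isotropic hypersurface with two distinct principal curvatures on a nonempty open set has
constant zero. -/
theorem IsLIsotropic.eq_zero_of_encard_eq_two (hx : IsLIsotropic x ξ lam) {U : Set M}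
    (hU : IsOpen U) (hne : U.Nonempty)
    (h2 : ∀ p ∈ U, (principalCurvatures x ξ p).encard = 2) : lam = 0 := by
  obtain ⟨p₀, hp₀⟩ := hne
  obtain ⟨φ, hφ, hp₀φ⟩ : ∃ φ ∈ atlas (Euc n) M, p₀ ∈ φ.source :=
    ⟨chartAt (Euc n) p₀, chart_mem_atlas _ _, mem_chart_source _ _⟩
  have h := hx.hypersurface
  -- A ball in the chart supplies the connectedness needed to make `s` and `A` constant.
  obtain ⟨ε, hε, hball⟩ := Metric.isOpen_iff.1 (φ.isOpen_inter_preimage_symm hU) (φ p₀)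
    ⟨φ.map_source hp₀φ, by simpa [φ.left_inv hp₀φ] using hp₀⟩
  have ht : ∀ u ∈ Metric.ball (φ p₀) ε, u ∈ φ.target := fun u hu => (hball hu).1
  -- The choices are made point by point, with no continuity in `u`; zeros are placeholders outside
  -- the ball.
  have key : ∀ u, ∃ (T : Euc n →ₗ[ℝ] Euc n) (R₁ R₂ : ℝ) (m₁ m₂ : ℕ), u ∈ Metric.ball (φ p₀) ε →
      (∀ v, dirD v (x ∘ φ.symm) u = -dirD (T v) (ξ ∘ φ.symm) u) ∧ TwoRadii T R₁ R₂ m₁ m₂ ∧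
      ∀ f : ℝ → ℝ, ∑ᶠ k : ℝ, (multiplicity x ξ (φ.symm u) k : ℝ) * f (1 / k) =
        m₁ * f R₁ + m₂ * f R₂ := by
    intro u
    by_cases hu : u ∈ Metric.ball (φ p₀) ε
    · obtain ⟨T, hT⟩ := exists_radiusOperator_chart hφ h hx.nonvanishing (ht u hu)
      obtain ⟨R₁, R₂, m₁, m₂, h12, hsum⟩ := exists_twoRadii
        (injective_normal_chart hφ h hx.nonvanishing (ht u hu)) (immersion_chart hφ h (ht u hu)) hT
        (second_form_symm_chart hφ h (ht u hu))
        ((congrArg Set.encard (principalCurvatures_eq_chart hφ h (ht u hu))).symm.trans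
          (h2 _ (hball hu).2))
      refine ⟨T, R₁, R₂, m₁, m₂, fun _ => ⟨hT, h12, fun f => ?_⟩⟩
      rw [← hsum f]
      exact finsum_congr fun k => by rw [multiplicity_eq_chart hφ h (ht u hu)]
    · exact ⟨0, 0, 0, 0, 0, fun h => absurd h hu⟩
  choose T R₁ R₂ m₁ m₂ hkey using key
  have hyp : TwoRadiiHypersurface (Metric.ball (φ p₀) ε) (x ∘ φ.symm) (ξ ∘ φ.symm)
      (rho x ξ ∘ φ.symm) (meanRadius x ξ ∘ φ.symm) T R₁ R₂ m₁ m₂ :=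
    { isOpen := Metric.isOpen_ball
      smooth_X := (contDiffOn_comp_chart_symm hφ h.smooth).mono ht
      smooth_Ξ := (contDiffOn_comp_chart_symm hφ h.smooth_normal).mono ht
      unit := fun u _ => h.unit _
      normal := fun u hu => normal_chart hφ h (ht u hu)
      inj := fun u hu => injective_normal_chart hφ h hx.nonvanishing (ht u hu)
      dX := fun u hu => (hkey u hu).1
      radii := fun u hu => (hkey u hu).2.1
      mean := fun u hu => by
        rw [Function.comp_apply, meanRadius, (hkey u hu).2.2 fun t => t]
      dev := fun u hu => by
        simp only [Function.comp_apply, rho]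
        rw [(hkey u hu).2.2 fun t => (meanRadius x ξ (φ.symm u) - t) ^ 2] }
  refine hyp.isotropic_constant_eq_zero (convex_ball _ _).isPreconnected
    ⟨_, Metric.mem_ball_self hε⟩ (fun u hu i => ?_) (fun u hu i j => ?_)
  · exact neg_eq_zero.1 (hx.form_eq_zero φ hφ u (ht u hu) i)
  · exact congrFun (congrFun (hx.tensor_eq φ hφ u (ht u hu)) i) j

end Chart

end Laguerre

end

/-! ### The theorem -/

theorem mainTheorem4 {n : ℕ} {M : Type*} [TopologicalSpace M]
    [ChartedSpace (EuclideanSpace ℝ (Fin n)) M] [IsManifold (𝓡 n) ∞ M] [Nonempty M]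
    (x ξ : M → EuclideanSpace ℝ (Fin (n + 1))) (lam : ℝ)
    (hx : Laguerre.IsLIsotropic x ξ lam) :
    ((∀ p, (Laguerre.principalCurvatures x ξ p).encard = 2) → lam = 0) ∧
    (3 ≤ n → 0 < lam →
      Dense {p : M | 3 ≤ (Laguerre.principalCurvatures x ξ p).encard} ∧
      ((∀ p q, (Laguerre.principalCurvatures x ξ p).encard =
          (Laguerre.principalCurvatures x ξ q).encard) →
        ∀ p, 3 ≤ (Laguerre.principalCurvatures x ξ p).encard)) := by
  refine ⟨fun h2 => hx.eq_zero_of_encard_eq_two isOpen_univ Set.univ_nonempty fun p _ => h2 p,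
    fun _ hlam => ?_⟩
  have hdense : Dense {p : M | 3 ≤ (Laguerre.principalCurvatures x ξ p).encard} := by
    rw [dense_iff_inter_open]
    intro U hU hne
    by_contra hcon
    -- An open set without points of three or more curvatures has exactly two at each point, so the
    -- local result forces `lam = 0`.
    refine hlam.ne' (hx.eq_zero_of_encard_eq_two hU hne fun p hp => ?_)
    refine le_antisymm (Order.le_of_lt_add_one ?_) (hx.two_le_encard p)
    by_contra! hle
    exact hcon ⟨p, hp, by simpa [show (2 : ℕ∞) + 1 = 3 from rfl] using hle⟩
  refine ⟨hdense, fun hconst p => ?_⟩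
  obtain ⟨q, hq⟩ := hdense.nonempty
  rw [hconst p q]
  exact hq
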